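/- Let $G$ be a 4-dimensional Lie group equipped with a left-invariant Riemannian metric $g=\langle\cdot,\cdot\rangle$, with Levi-Civita connection $\nabla$ and Lie algebra $\mathfrak g$. Let $\mathcal F$ be a left-invariant foliation of codimension 2 on $G$, with tangent distribution $\mathcal V$ (smooth, involutive, left-invariant, of rank 2), and let $\mathcal H=\mathcal V^\perp$; write $\mathcal V,\mathcal H$ also for the orthogonal projections. Put $B^{\mathcal V}(U,V)=\frac12\mathcal H(\nabla_UV+\nabla_VU)$ for $U,V\in\mathcal V$ and $B^{\mathcal H}(X,Y)=\frac12\mathcal V(\nabla_XY+\nabla_YX)$ for $X,Y\in\mathcal H$. Assume that $\mathcal F$ is conformal, i.e. $B^{\mathcal H}=g\otimes V$ for some vector field $V\in\mathcal V$, and that it has minimal leaves, i.e. $\operatorname{trace}B^{\mathcal V}=0$. Then there is an orthonormal basis $\{X,Y,Z,W\}$ of $\mathfrak g$ such that $\mathcal V$ is spanned at every point by the left-invariant vector fields $Z,W$, and such that the Lie brackets are those of one of the following families $\mathfrak g_1,\dots,\mathfrak g_{20}$ for some real values of the parameters. (Brackets of basis elements that are not listed are zero; parameters are arbitrary real numbers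 subject to the stated conditions.) * $\mathfrak g_1(\lambda,r,w_1,w_2)$, $\lambda\ne0$, $r\neq 0$: $[W,Z]=\lambda W$, $[Z,X]=w_1W$, $[Z,Y]=w_2W$, $[Y,X]=rX+\frac{rw_1}{\lambda}W$. * $\mathfrak g_2(\lambda,\alpha,\beta,w_1,w_2)$, $\lambda\ne0$, $(\lambda-\alpha)^2+\beta^2\ne0$: $[W,Z]=\lambda W$, $[Z,X]=\alpha X+\beta Y+w_1W$, $[Z,Y]=-\beta X+\alpha Y+w_2W$. * $\mathfrak g_3(\alpha,\beta,w_1,w_2,\theta_2)$, $\alpha\ne0$, $\theta_2\ne0$: $[W,Z]=-2\alpha W$, $[Z,X]=\alpha X+\beta Y+w_1W$, $[Z,Y]=-\beta X+\alpha Y+w_2W$, $[Y,X]=\theta_2W$. * $\mathfrak g_4(\lambda,z_2,w_1,w_2)$, $\lambda\ne0$: $[W,Z]=\lambda W$, $[Z,X]=\lambda X+w_1W$, $[Z,Y]=\lambda Y+z_2Z+w_2W$, $[W,Y]=-z_2W$, $[Y,X]=-z_2X-\frac{z_2w_1}{\lambda}W$. * $\mathfrak g_5(\alpha,a,\beta,b,r)$,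 $r\ne0$, $D:=a\beta-\alpha b\ne0$: $[Z,X]=\alpha X+\beta Y+\frac{r(\beta b-\alpha a)}{2D}Z+\frac{r(\alpha^2-\beta^2)}{2D}W$, $[Z,Y]=-\beta X+\alpha Y+\frac{r(\alpha b+\beta a)}{2D}Z-\frac{r\alpha\beta}{D}W$, $[W,X]=aX+bY+\frac{r(b^2-a^2)}{2D}Z+\frac{r(\alpha a-\beta b)}{2D}W$, $[W,Y]=-bX+aY+\frac{rab}{D}Z-\frac{r(\alpha b+\beta a)}{2D}W$, $[Y,X]=rX-\frac{ar^2}{2D}Z+\frac{\alpha r^2}{2D}W$. * $\mathfrak g_6(z_1,z_2,z_3,r,\theta_1,\theta_2)$, $r,z_1,z_3\ne0$: $[Z,X]=z_1Z-\frac{z_1^2}{z_3}W$, $[Z,Y]=z_2Z+\frac{z_1(r-2z_2)}{2z_3}W$, $[W,X]=z_3Z-z_1W$, $[W,Y]=\frac{z_3(r+2z_2)}{2z_1}Z-z_2W$, $[Y,X]=rX+\theta_1Z+\theta_2W$. * $\mathfrak g_7(z_2,w_1,w_2,\theta_1,\theta_2)$, $z_2,w_1\ne0$: $[Z,X]=w_1W$,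 $[Z,Y]=z_2Z+w_2W$, $[W,Y]=-z_2W$, $[Y,X]=2z_2X+\theta_1Z+\theta_2W$. * $\mathfrak g_8(z_2,z_4,w_2,r,\theta_1,\theta_2)$, $r\ne0$: $[Z,Y]=z_2Z+w_2W$, $[W,Y]=z_4Z-z_2W$, $[Y,X]=rX+\theta_1Z+\theta_2W$. * $\mathfrak g_9(z_2,z_3,z_4,\theta_1,\theta_2)$, $z_2\ne0$: $[Z,Y]=z_2Z$, $[W,X]=z_3Z$, $[W,Y]=z_4Z-z_2W$, $[Y,X]=-2z_2X+\theta_1Z+\theta_2W$. * $\mathfrak g_{10}(\alpha,a,\beta,b)$, $\alpha b-a\beta\ne0$: $[Z,X]=\alpha X+\beta Y$, $[Z,Y]=-\beta X+\alpha Y$, $[W,X]=aX+bY$, $[W,Y]=-bX+aY$. * $\mathfrak g_{11}(z_1,z_2,z_3,w_1,\theta_1,\theta_2)$, $z_1\ne0$: $[Z,X]=z_1Z+w_1W$, $[Z,Y]=z_2Z+\frac{z_2w_1}{z_1}W$, $[W,X]=z_3Z-z_1W$, $[W,Y]=\frac{z_2z_3}{z_1}Z-z_2W$, $[Y,X]=\theta_1Z+\theta_2W$.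 * $\mathfrak g_{12}(z_3,w_1,w_2,\theta_1,\theta_2)$, $w_1\ne0$: $[Z,X]=w_1W$, $[Z,Y]=w_2W$, $[W,X]=z_3Z$, $[W,Y]=\frac{z_3w_2}{w_1}Z$, $[Y,X]=\theta_1Z+\theta_2W$. * $\mathfrak g_{13}(z_3,z_4,\theta_1,\theta_2)$, $z_3\ne0$: $[W,X]=z_3Z$, $[W,Y]=z_4Z$, $[Y,X]=\theta_1Z+\theta_2W$. * $\mathfrak g_{14}(z_2,z_4,w_2,\theta_1,\theta_2)$: $[Z,Y]=z_2Z+w_2W$, $[W,Y]=z_4Z-z_2W$, $[Y,X]=\theta_1Z+\theta_2W$. * $\mathfrak g_{15}(\alpha,w_1,w_2)$, $\alpha\ne0$: $[Z,X]=\alpha X+w_1W$, $[Z,Y]=\alpha Y+w_2W$. * $\mathfrak g_{16}(\beta,w_1,w_2,\theta_1,\theta_2)$, $\beta\ne0$: $[Z,X]=\beta Y+w_1W$, $[Z,Y]=-\beta X+w_2W$, $[Y,X]=\theta_1Z+\theta_2W$. * $\mathfrak g_{17}(\alpha,a,w_1,w_2)$, $\alpha,a\ne0$: $[Z,X]=\alpha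 X-\frac{aw_1}{\alpha}Z+w_1W$, $[Z,Y]=\alpha Y-\frac{aw_2}{\alpha}Z+w_2W$, $[W,X]=aX-\frac{a^2w_1}{\alpha^2}Z+\frac{aw_1}{\alpha}W$, $[W,Y]=aY-\frac{a^2w_2}{\alpha^2}Z+\frac{aw_2}{\alpha}W$. * $\mathfrak g_{18}(\beta,b,z_3,z_4,\theta_1,\theta_2)$, $\beta,b\ne0$: $[Z,X]=\beta Y+\frac{\beta z_3}{b}Z-\frac{\beta^2z_3}{b^2}W$, $[Z,Y]=-\beta X+\frac{\beta z_4}{b}Z-\frac{\beta^2z_4}{b^2}W$, $[W,X]=bY+z_3Z-\frac{\beta z_3}{b}W$, $[W,Y]=-bX+z_4Z-\frac{\beta z_4}{b}W$, $[Y,X]=\theta_1Z+\theta_2W$. * $\mathfrak g_{19}(\alpha,\beta,w_1,w_2)$, $\alpha,\beta\ne0$: $[Z,X]=\alpha X+\beta Y+w_1W$, $[Z,Y]=-\beta X+\alpha Y+w_2W$. * $\mathfrak g_{20}(\alpha,a,\beta,w_1,w_2)$, $\alpha,a,\beta\ne0$: $[Z,X]=\alpha X+\beta Y-\frac{aw_1}{\alpha}Z+w_1W$,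 $[Z,Y]=-\beta X+\alpha Y-\frac{aw_2}{\alpha}Z+w_2W$, $[W,X]=aX+\frac{\beta a}{\alpha}Y-\frac{a^2w_1}{\alpha^2}Z+\frac{aw_1}{\alpha}W$, $[W,Y]=-\frac{\beta a}{\alpha}X+aY-\frac{a^2w_2}{\alpha^2}Z+\frac{aw_2}{\alpha}W$. -/

import Mathlib

open scoped Manifold ContDiff Topology

set_option linter.unusedSectionVars false

namespace LeviCivita

section

open Bundle VectorField

variable {E : Type*} [NormedAddCommGroup E] [NormedSpace ℝ E]
  {H : Type*} [TopologicalSpace H] {I : ModelWithCorners ℝ E H}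
  {M : Type*} [TopologicalSpace M] [ChartedSpace H M]

theorem finiteDimensional_tangentSpace [FiniteDimensional ℝ E] (x : M) : FiniteDimensional ℝ (TangentSpace I x) :=
  inferInstanceAs (FiniteDimensional ℝ E)

variable [RiemannianBundle (fun x : M => TangentSpace I x)]

section

variable [FiniteDimensional ℝ E] {x : M}

/-- The tangent vector that represents a linear form. -/
noncomputable def dual (x : M) (a : TangentSpace I x →L[ℝ] ℝ) : TangentSpace I x :=
  haveI := finiteDimensional_tangentSpace (I := I) x
  haveI := FiniteDimensional.complete ℝ (TangentSpace I x)
  (InnerProductSpace.toDual ℝ (TangentSpace I x)).symm a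

theorem inner_dual (x : M) (a : TangentSpace I x →L[ℝ] ℝ) (v : TangentSpace I x) :
    inner ℝ (dual x a) v = a v := by
  have := finiteDimensional_tangentSpace (I := I) x
  have := FiniteDimensional.complete ℝ (TangentSpace I x)
  exact InnerProductSpace.toDual_symm_apply

/-- The endomorphism that represents a bilinear form. -/
noncomputable def dualHom (x : M) (K : TangentSpace I x →L[ℝ] TangentSpace I x →L[ℝ] ℝ) :
    TangentSpace I x →L[ℝ] TangentSpace I x :=
  haveI := finiteDimensional_tangentSpace (I := I) x
  LinearMap.toContinuousLinearMap
    { toFun := fun v => dual x (K v)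
      map_add' := fun v w => ext_inner_right ℝ fun u => by
        rw [inner_add_left, inner_dual, inner_dual, inner_dual, map_add]; rfl
      map_smul' := fun c v => ext_inner_right ℝ fun u => by
        rw [real_inner_smul_left, inner_dual, inner_dual, map_smul]; rfl }

theorem inner_dualHom (x : M) (K : TangentSpace I x →L[ℝ] TangentSpace I x →L[ℝ] ℝ)
    (v w : TangentSpace I x) : inner ℝ (dualHom x K v) w = K v w :=
  inner_dual x (K v) w

end

variable [IsManifold I 2 M]

/-- The Koszul expression: for the Levi-Civita connection `∇` of the Riemannian metric and vector
fields `X`, `Y`, `Z` that are differentiable at `x`, it is the value of `⟨∇_X Y, Z⟩` at `x`. -/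
noncomputable def koszul (X Y Z : Π x : M, TangentSpace I x) (x : M) : ℝ :=
  (1 / 2) * (d% (fun y => inner ℝ (Y y) (Z y)) x (X x)
    + d% (fun y => inner ℝ (X y) (Z y)) x (Y x)
    - d% (fun y => inner ℝ (X y) (Y y)) x (Z x)
    + inner ℝ (mlieBracket I X Y x) (Z x)
    - inner ℝ (mlieBracket I X Z x) (Y x)
    - inner ℝ (mlieBracket I Y Z x) (X x))

/-- A smooth Riemannian metric is in particular continuously differentiable. -/
instance instRiemannianOne [h : IsContMDiffRiemannianBundle I ∞ E (fun x : M => TangentSpace I x)] :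
    IsContMDiffRiemannianBundle I 1 E (fun x : M => TangentSpace I x) :=
  h.of_le (by norm_cast)

variable [IsContMDiffRiemannianBundle I 1 E (fun x : M => TangentSpace I x)]

variable {X X' Y Y' Z Z' : Π x : M, TangentSpace I x} {f : M → ℝ} {x : M}

theorem mdiff_inner (hX : MDiffAt (T% X) x) (hY : MDiffAt (T% Y) x) :
    MDiffAt (fun y => inner ℝ (X y) (Y y)) x :=
  MDifferentiableAt.inner_bundle (F := E) (E := fun x : M => TangentSpace I x)
    (IM := I) (IB := I) (b := fun y => y) hX hY

theorem d_inner_comm (v : TangentSpace I x) :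
   d% (fun y => inner ℝ (X y) (Y y)) x v = d% (fun y => inner ℝ (Y y) (X y)) x v := by
  congr 2; funext y; exact real_inner_comm _ _

theorem d_inner_add (hX : MDiffAt (T% X) x) (hX' : MDiffAt (T% X') x) (hY : MDiffAt (T% Y) x)
    (v : TangentSpace I x) :
   d% (fun y => inner ℝ ((X + X') y) (Y y)) x v
     = d% (fun y => inner ℝ (X y) (Y y)) x v + d% (fun y => inner ℝ (X' y) (Y y)) x v := by
  have h := mvfderiv_add (mdiff_inner hX hY) (mdiff_inner hX' hY)
  have h2 : (fun y => inner ℝ ((X + X') y) (Y y)) =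
    (fun y => inner ℝ (X y) (Y y)) + (fun y => inner ℝ (X' y) (Y y)) := by
    funext y; exact inner_add_left _ _ _
  rw [h2, h]; rfl

theorem d_inner_smul (hf : MDiffAt f x) (hX : MDiffAt (T% X) x) (hY : MDiffAt (T% Y) x)
    (v : TangentSpace I x) :
   d% (fun y => inner ℝ ((f • X) y) (Y y)) x v
     = f x * d% (fun y => inner ℝ (X y) (Y y)) x v + d% f x v * inner ℝ (X x) (Y x) := by
  have h := mvfderiv_mul hf (mdiff_inner hX hY)
  have h2 : (fun y => inner ℝ ((f • X) y) (Y y)) =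
    f * (fun y => inner ℝ (X y) (Y y)) := by
    funext y; exact real_inner_smul_left _ _ _
  rw [h2, h]; simp [mul_comm]

theorem d_inner_add' (hX : MDiffAt (T% X) x) (hX' : MDiffAt (T% X') x) (hY : MDiffAt (T% Y) x)
    (v : TangentSpace I x) :
   d% (fun y => inner ℝ (Y y) ((X + X') y)) x v
     = d% (fun y => inner ℝ (Y y) (X y)) x v + d% (fun y => inner ℝ (Y y) (X' y)) x v := by
  rw [d_inner_comm, d_inner_add hX hX' hY, d_inner_comm, d_inner_comm (X := X')]

theorem d_inner_smul' (hf : MDiffAt f x) (hX : MDiffAt (T% X) x) (hY : MDiffAt (T% Y) x)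
    (v : TangentSpace I x) :
   d% (fun y => inner ℝ (Y y) ((f • X) y)) x v
     = f x * d% (fun y => inner ℝ (Y y) (X y)) x v + d% f x v * inner ℝ (Y x) (X x) := by
  rw [d_inner_comm, d_inner_smul hf hX hY, d_inner_comm, real_inner_comm]

variable [CompleteSpace E]

theorem koszul_add_left  (hX : MDiffAt (T% X) x) (hX' : MDiffAt (T% X') x)
    (hY : MDiffAt (T% Y) x) (hZ : MDiffAt (T% Z) x) :
    koszul (X + X') Y Z x = koszul X Y Z x + koszul X' Y Z x := by
  simp only [koszul]
  rw [d_inner_add hX hX' hZ, d_inner_add hX hX' hY, mlieBracket_add_left hX hX',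
    mlieBracket_add_left hX hX']
  simp only [Pi.add_apply, map_add, inner_add_left, inner_add_right]
  ring

theorem koszul_smul_left (hf : MDiffAt f x) (hX : MDiffAt (T% X) x)
    (hY : MDiffAt (T% Y) x) (hZ : MDiffAt (T% Z) x) :
    koszul (f • X) Y Z x = f x * koszul X Y Z x := by
  simp only [koszul]
  rw [d_inner_smul hf hX hZ, d_inner_smul hf hX hY, mlieBracket_smul_left hf hX,
    mlieBracket_smul_left hf hX]
  simp only [Pi.smul_apply', map_smul, inner_add_left, real_inner_smul_left,
    real_inner_smul_right, smul_eq_mul]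
  ring

theorem koszul_add_right  (hX : MDiffAt (T% X) x) (hY : MDiffAt (T% Y) x)
    (hZ : MDiffAt (T% Z) x) (hZ' : MDiffAt (T% Z') x) :
    koszul X Y (Z + Z') x = koszul X Y Z x + koszul X Y Z' x := by
  simp only [koszul]
  rw [d_inner_add' hZ hZ' hX, d_inner_add' hZ hZ' hY, mlieBracket_add_right hZ hZ',
    mlieBracket_add_right hZ hZ']
  simp only [Pi.add_apply, map_add, inner_add_left, inner_add_right]
  ring

theorem koszul_smul_right (hf : MDiffAt f x) (hX : MDiffAt (T% X) x)
    (hY : MDiffAt (T% Y) x) (hZ : MDiffAt (T% Z) x) :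
    koszul X Y (f • Z) x = f x * koszul X Y Z x := by
  simp only [koszul]
  rw [d_inner_smul' hf hZ hX, d_inner_smul' hf hZ hY, mlieBracket_smul_right hf hZ,
    mlieBracket_smul_right hf hZ]
  simp only [Pi.smul_apply', map_smul, inner_add_left, real_inner_smul_left,
    real_inner_smul_right, smul_eq_mul]
  rw [real_inner_comm (Z x) (X x), real_inner_comm (Z x) (Y x)]
  ring

theorem koszul_add_mid  (hX : MDiffAt (T% X) x) (hY : MDiffAt (T% Y) x)
    (hY' : MDiffAt (T% Y') x) (hZ : MDiffAt (T% Z) x) :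
    koszul X (Y + Y') Z x = koszul X Y Z x + koszul X Y' Z x := by
  simp only [koszul]
  rw [d_inner_add' hY hY' hX, d_inner_add hY hY' hZ, mlieBracket_add_right hY hY',
    mlieBracket_add_left hY hY']
  simp only [Pi.add_apply, map_add, inner_add_left, inner_add_right]
  ring

theorem koszul_smul_mid (hf : MDiffAt f x) (hX : MDiffAt (T% X) x)
    (hY : MDiffAt (T% Y) x) (hZ : MDiffAt (T% Z) x) :
    koszul X (f • Y) Z x = f x * koszul X Y Z x + d% f x (X x) * inner ℝ (Y x) (Z x) := by
  simp only [koszul]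
  rw [d_inner_smul' hf hY hX, d_inner_smul hf hY hZ, mlieBracket_smul_right hf hY,
    mlieBracket_smul_left hf hY]
  simp only [Pi.smul_apply', map_smul, inner_add_left, real_inner_smul_left,
    real_inner_smul_right, smul_eq_mul]
  rw [real_inner_comm (Y x) (X x)]
  ring

variable [FiniteDimensional ℝ E]

/-- For `Y` differentiable at `x`, the Koszul expression depends on `X`, `Z` only through their
values at `x`; this is the resulting bilinear form on the tangent space. -/
noncomputable def koszulForm (Y : Π x : M, TangentSpace I x) (x : M) (hY : MDiffAt (T% Y) x) :
    TangentSpace I x →L[ℝ] TangentSpace I x →L[ℝ] ℝ :=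
  TensorialAt.mkHom₂ (I := I) (F := E) (F' := E) (fun X Z => koszul X Y Z x) x
    (fun _ hZ => ⟨fun hf hX => koszul_smul_left hf hX hY hZ,
      fun hX hX' => koszul_add_left hX hX' hY hZ⟩)
    (fun _ hX => ⟨fun hf hZ => koszul_smul_right hf hX hY hZ,
      fun hZ hZ' => koszul_add_right hX hY hZ hZ'⟩)

theorem koszulForm_apply (hX : MDiffAt (T% X) x) (hY : MDiffAt (T% Y) x)
    (hZ : MDiffAt (T% Z) x) :
    koszulForm Y x hY (X x) (Z x) = koszul X Y Z x :=
  TensorialAt.mkHom₂_apply _ _ hX hZ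


open Classical in
/-- The covariant derivative `v ↦ ∇_v Y` at `x`, with the value `0` if `Y` is not differentiable
at `x`. -/
noncomputable def conn (Y : Π x : M, TangentSpace I x) (x : M) :
    TangentSpace I x →L[ℝ] TangentSpace I x :=
  if hY : MDiffAt (T% Y) x then dualHom x (koszulForm Y x hY) else 0

theorem inner_conn (hX : MDiffAt (T% X) x) (hY : MDiffAt (T% Y) x) (hZ : MDiffAt (T% Z) x) :
    inner ℝ (conn Y x (X x)) (Z x) = koszul X Y Z x := by
  rw [conn, dif_pos hY, inner_dualHom, koszulForm_apply hX hY hZ]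

theorem ext_extend {A B : TangentSpace I x →L[ℝ] TangentSpace I x}
    (h : ∀ X Z : Π x : M, TangentSpace I x, MDiffAt (T% X) x → MDiffAt (T% Z) x →
      inner ℝ (A (X x)) (Z x) = inner ℝ (B (X x)) (Z x)) : A = B := by
  refine ContinuousLinearMap.ext fun v => ext_inner_right ℝ fun w => ?_
  have := h (FiberBundle.extend E v) (FiberBundle.extend E w)
    (FiberBundle.mdifferentiableAt_extend ..) (FiberBundle.mdifferentiableAt_extend ..)
  simpa using this

variable (I M) in
/-- The Levi-Civita connection of the Riemannian metric: it is torsion-free and metric, by the two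
theorems that follow. The term `leviCivita I M Y x (X x)` is the value of `∇_X Y` at `x`. -/
noncomputable def leviCivita : CovariantDerivative I E (fun x : M => TangentSpace I x) where
  toFun := conn
  isCovariantDerivativeOnUniv :=
    { add := fun {Y Y' x} hY hY' _ => ext_extend fun X Z hX hZ => by
        rw [inner_conn hX (mdifferentiableAt_add_section hY hY') hZ, add_apply, inner_add_left,
          inner_conn hX hY hZ, inner_conn hX hY' hZ, koszul_add_mid hX hY hY' hZ]
      leibniz := fun {Y f x} hY hf _ => ext_extend fun X Z hX hZ => by
        rw [inner_conn hX (hf.smul_section hY) hZ, koszul_smul_mid hf hX hY hZ,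
          add_apply, inner_add_left, smul_apply,
          ContinuousLinearMap.smulRight_apply,
          real_inner_smul_left, real_inner_smul_left, inner_conn hX hY hZ] }

theorem leviCivita_torsion : (leviCivita I M).torsion = 0 := by
  rw [CovariantDerivative.torsion_eq_zero_iff]
  intro X Y x hX hY
  refine ext_inner_right ℝ fun w => ?_
  have hZ : MDiffAt (T% (FiberBundle.extend E w)) x := FiberBundle.mdifferentiableAt_extend ..
  have h1 := inner_conn hX hY hZ
  have h2 := inner_conn hY hX hZ
  rw [FiberBundle.extend_apply_self] at h1 h2
  rw [inner_sub_left]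
  change inner ℝ (conn Y x (X x)) w - inner ℝ (conn X x (Y x)) w = _
  rw [h1, h2]
  simp only [koszul, FiberBundle.extend_apply_self]
  rw [mlieBracket_swap_apply (V := Y) (W := X), d_inner_comm (X := Y) (Y := X), inner_neg_left]
  ring

theorem leviCivita_metric (hX : MDiffAt (T% X) x) (hY : MDiffAt (T% Y) x)
    (hZ : MDiffAt (T% Z) x) :
    d% (fun y => inner ℝ (Y y) (Z y)) x (X x) =
      inner ℝ (leviCivita I M Y x (X x)) (Z x) + inner ℝ (Y x) (leviCivita I M Z x (X x)) := by
  change _ = inner ℝ (conn Y x (X x)) (Z x) + inner ℝ (Y x) (conn Z x (X x))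
  rw [inner_conn hX hY hZ, real_inner_comm (conn Z x (X x)), inner_conn hX hZ hY]
  simp only [koszul]
  rw [mlieBracket_swap_apply (V := Z) (W := Y), d_inner_comm (X := Z) (Y := Y), inner_neg_left]
  ring

end

end LeviCivita

namespace Foliation

section

open Bundle VectorField Module

variable {E : Type*} [NormedAddCommGroup E] [NormedSpace ℝ E]
  {H : Type*} [TopologicalSpace H] {I : ModelWithCorners ℝ E H}
  {M : Type*} [TopologicalSpace M] [ChartedSpace H M] [IsManifold I 2 M]

/-- On a neighbourhood of `x`, the vector field `U` is smooth and tangent to the distribution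
`𝒱`. -/
def IsSectionNear (𝒱 : Π x : M, Submodule ℝ (TangentSpace I x))
    (U : Π x : M, TangentSpace I x) (x : M) : Prop :=
  ∀ᶠ y in 𝓝 x, CMDiffAt ∞ (T% U) y ∧ U y ∈ 𝒱 y

/-- `𝒱` is the tangent distribution of a smooth foliation of codimension `q`: it is a smooth
distribution of constant corank `q` that is involutive. -/
structure IsFoliation (𝒱 : Π x : M, Submodule ℝ (TangentSpace I x)) (q : ℕ) : Prop where
  codim : ∀ x, finrank ℝ (𝒱 x) + q = finrank ℝ (TangentSpace I x)
  smooth : ∀ x, ∀ v ∈ 𝒱 x, ∃ U : Π y : M, TangentSpace I y, IsSectionNear 𝒱 U x ∧ U x = v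
  involutive : ∀ (x : M) (U V : Π y : M, TangentSpace I y),
    IsSectionNear 𝒱 U x → IsSectionNear 𝒱 V x → mlieBracket I U V x ∈ 𝒱 x

variable [RiemannianBundle (fun x : M => TangentSpace I x)]

/-- The orthogonal complement of a distribution. -/
noncomputable def horizontal (𝒱 : Π x : M, Submodule ℝ (TangentSpace I x)) :
    Π x : M, Submodule ℝ (TangentSpace I x) :=
  fun x => (𝒱 x)ᗮ

variable [FiniteDimensional ℝ E]

/-- The orthogonal projection of the tangent space at `x` onto a subspace. -/
noncomputable def proj {x : M} (K : Submodule ℝ (TangentSpace I x)) (v : TangentSpace I x) :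
    TangentSpace I x :=
  haveI := LeviCivita.finiteDimensional_tangentSpace (I := I) x
  K.starProjection v

variable [CompleteSpace E]
  [IsContMDiffRiemannianBundle I ∞ E (fun x : M => TangentSpace I x)]

/-- The second fundamental form of a distribution `𝒲`, for vector fields `U`, `V` tangent to `𝒲`:
half the component of `∇_U V + ∇_V U` orthogonal to `𝒲`, with `∇` the Levi-Civita connection. -/
noncomputable def secondForm (𝒲 : Π x : M, Submodule ℝ (TangentSpace I x))
    (U V : Π x : M, TangentSpace I x) (x : M) : TangentSpace I x :=
  (1 / 2 : ℝ) • proj (horizontal 𝒲 x)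
    (LeviCivita.leviCivita I M V x (U x) + LeviCivita.leviCivita I M U x (V x))

/-- The foliation tangent to `𝒱` is conformal: the second fundamental form of the orthogonal
complement of `𝒱` is `g ⊗ V` for some smooth vector field `V` tangent to `𝒱`. -/
def IsConformal (𝒱 : Π x : M, Submodule ℝ (TangentSpace I x)) : Prop :=
  ∃ V : Π x : M, TangentSpace I x, (∀ x, IsSectionNear 𝒱 V x) ∧
    ∀ (x : M) (A B : Π y : M, TangentSpace I y),
      IsSectionNear (horizontal 𝒱) A x → IsSectionNear (horizontal 𝒱) B x →
      secondForm (horizontal 𝒱) A B x = (inner ℝ (A x) (B x) : ℝ) • V x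

/-- The foliation tangent to `𝒱` has minimal leaves: the trace of the second fundamental form
of `𝒱` vanishes. -/
def IsMinimal (𝒱 : Π x : M, Submodule ℝ (TangentSpace I x)) : Prop :=
  ∀ (x : M) (U : Fin (finrank ℝ (𝒱 x)) → Π y : M, TangentSpace I y),
    (∀ i, IsSectionNear 𝒱 (U i) x) → Orthonormal ℝ (fun i => U i x) →
    ∑ i, secondForm 𝒱 (U i) (U i) x = 0

end

end Foliation

namespace LieGroupGeometry

section

open Bundle

variable {E : Type*} [NormedAddCommGroup E] [NormedSpace ℝ E]
  {H : Type*} [TopologicalSpace H] (I : ModelWithCorners ℝ E H)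
  (G : Type*) [TopologicalSpace G] [ChartedSpace H G] [Group G]

/-- The Riemannian metric of the Lie group `G` is left-invariant. -/
def IsLeftInvariantMetric [RiemannianBundle (fun x : G => TangentSpace I x)] : Prop :=
  ∀ (g h : G) (v w : TangentSpace I h),
    (inner ℝ (mfderiv% (fun x : G => g * x) h v) (mfderiv% (fun x : G => g * x) h w) : ℝ)
      = inner ℝ v w

variable {I G}

/-- The distribution `𝒱` on the Lie group `G` is left-invariant. -/
def IsLeftInvariant (𝒱 : Π x : G, Submodule ℝ (TangentSpace I x)) : Prop :=
  ∀ (g h : G) (v : TangentSpace I h), v ∈ 𝒱 h ↔ mfderiv% (fun x : G => g * x) h v ∈ 𝒱 (g * h)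

/-- `X, Y, Z, W` are orthonormal elements of the Lie algebra of `G`, and at each point the
distribution `𝒱` is spanned by the left-invariant vector fields of `Z` and `W`. -/
def IsAdaptedFrame [RiemannianBundle (fun x : G => TangentSpace I x)]
    (𝒱 : Π x : G, Submodule ℝ (TangentSpace I x)) (X Y Z W : GroupLieAlgebra I G) : Prop :=
  Orthonormal ℝ (E := TangentSpace I (1 : G)) ![X, Y, Z, W] ∧
    ∀ g : G, 𝒱 g = Submodule.span ℝ {mulInvariantVectorField Z g, mulInvariantVectorField W g}

/-- The six brackets of the elements `X, Y, Z, W` have the given values. -/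
def HasBrackets {L : Type*} [Bracket L L] (X Y Z W wz zx zy wx wy yx : L) : Prop :=
  ⁅W, Z⁆ = wz ∧ ⁅Z, X⁆ = zx ∧ ⁅Z, Y⁆ = zy ∧ ⁅W, X⁆ = wx ∧ ⁅W, Y⁆ = wy ∧ ⁅Y, X⁆ = yx

end

section

variable {L : Type*} [AddCommGroup L] [Module ℝ L] [Bracket L L]

/-- The brackets of `X, Y, Z, W` are those of one of the twenty families. -/
inductive InFamilies (X Y Z W : L) : Prop
  | g1 (lam r w₁ w₂ : ℝ) (hlam : lam ≠ 0) (hr : r ≠ 0)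
      (h : HasBrackets X Y Z W
        (lam • W)
        (w₁ • W)
        (w₂ • W)
        0
        0
        (r • X + (r * w₁ / lam) • W))
  | g2 (lam α β w₁ w₂ : ℝ) (hlam : lam ≠ 0) (hA : (lam - α) ^ 2 + β ^ 2 ≠ 0)
      (h : HasBrackets X Y Z W
        (lam • W)
        (α • X + β • Y + w₁ • W)
        (-β • X + α • Y + w₂ • W)
        0
        0
        0)
  | g3 (α β w₁ w₂ θ₂ : ℝ) (hα : α ≠ 0) (hθ : θ₂ ≠ 0)
      (h : HasBrackets X Y Z W
        ((-2 * α) • W)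
        (α • X + β • Y + w₁ • W)
        (-β • X + α • Y + w₂ • W)
        0
        0
        (θ₂ • W))
  | g4 (lam z₂ w₁ w₂ : ℝ) (hlam : lam ≠ 0)
      (h : HasBrackets X Y Z W
        (lam • W)
        (lam • X + w₁ • W)
        (lam • Y + z₂ • Z + w₂ • W)
        0
        (-z₂ • W)
        (-z₂ • X + (-z₂ * w₁ / lam) • W))
  | g5 (α a β b r : ℝ) (hr : r ≠ 0) (hd : a * β - α * b ≠ 0)
      (h : HasBrackets X Y Z W
        0
        (α • X + β • Y + (r * (β * b - α * a) / (2 * (a * β - α * b))) • Z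
          + (r * (α ^ 2 - β ^ 2) / (2 * (a * β - α * b))) • W)
        (-β • X + α • Y + (r * (α * b + β * a) / (2 * (a * β - α * b))) • Z
          + (-(r * α * β / (a * β - α * b))) • W)
        (a • X + b • Y + (r * (b ^ 2 - a ^ 2) / (2 * (a * β - α * b))) • Z
          + (r * (α * a - β * b) / (2 * (a * β - α * b))) • W)
        (-b • X + a • Y + (r * a * b / (a * β - α * b)) • Z
          + (-(r * (α * b + β * a) / (2 * (a * β - α * b)))) • W)
        (r • X + (-(a * r ^ 2 / (2 * (a * β - α * b)))) • Z
          + (α * r ^ 2 / (2 * (a * β - α * b))) • W))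
  | g6 (z₁ z₂ z₃ r θ₁ θ₂ : ℝ) (hr : r ≠ 0) (hz₁ : z₁ ≠ 0) (hz₃ : z₃ ≠ 0)
      (h : HasBrackets X Y Z W
        0
        (z₁ • Z + (-(z₁ ^ 2 / z₃)) • W)
        (z₂ • Z + (z₁ * (r - 2 * z₂) / (2 * z₃)) • W)
        (z₃ • Z + -z₁ • W)
        ((z₃ * (r + 2 * z₂) / (2 * z₁)) • Z + -z₂ • W)
        (r • X + θ₁ • Z + θ₂ • W))
  | g7 (z₂ w₁ w₂ θ₁ θ₂ : ℝ) (hz₂ : z₂ ≠ 0) (hw₁ : w₁ ≠ 0)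
      (h : HasBrackets X Y Z W
        0
        (w₁ • W)
        (z₂ • Z + w₂ • W)
        0
        (-z₂ • W)
        ((2 * z₂) • X + θ₁ • Z + θ₂ • W))
  | g8 (z₂ z₄ w₂ r θ₁ θ₂ : ℝ) (hr : r ≠ 0)
      (h : HasBrackets X Y Z W
        0
        0
        (z₂ • Z + w₂ • W)
        0
        (z₄ • Z + -z₂ • W)
        (r • X + θ₁ • Z + θ₂ • W))
  | g9 (z₂ z₃ z₄ θ₁ θ₂ : ℝ) (hz₂ : z₂ ≠ 0)
      (h : HasBrackets X Y Z W
        0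
        0
        (z₂ • Z)
        (z₃ • Z)
        (z₄ • Z + -z₂ • W)
        ((-2 * z₂) • X + θ₁ • Z + θ₂ • W))
  | g10 (α a β b : ℝ) (hd : α * b - a * β ≠ 0)
      (h : HasBrackets X Y Z W
        0
        (α • X + β • Y)
        (-β • X + α • Y)
        (a • X + b • Y)
        (-b • X + a • Y)
        0)
  | g11 (z₁ z₂ z₃ w₁ θ₁ θ₂ : ℝ) (hz₁ : z₁ ≠ 0)
      (h : HasBrackets X Y Z W
        0
        (z₁ • Z + w₁ • W)
        (z₂ • Z + (z₂ * w₁ / z₁) • W)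
        (z₃ • Z + -z₁ • W)
        ((z₂ * z₃ / z₁) • Z + -z₂ • W)
        (θ₁ • Z + θ₂ • W))
  | g12 (z₃ w₁ w₂ θ₁ θ₂ : ℝ) (hw₁ : w₁ ≠ 0)
      (h : HasBrackets X Y Z W
        0
        (w₁ • W)
        (w₂ • W)
        (z₃ • Z)
        ((z₃ * w₂ / w₁) • Z)
        (θ₁ • Z + θ₂ • W))
  | g13 (z₃ z₄ θ₁ θ₂ : ℝ) (hz₃ : z₃ ≠ 0)
      (h : HasBrackets X Y Z W
        0
        0
        0
        (z₃ • Z)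
        (z₄ • Z)
        (θ₁ • Z + θ₂ • W))
  | g14 (z₂ z₄ w₂ θ₁ θ₂ : ℝ)
      (h : HasBrackets X Y Z W
        0
        0
        (z₂ • Z + w₂ • W)
        0
        (z₄ • Z + -z₂ • W)
        (θ₁ • Z + θ₂ • W))
  | g15 (α w₁ w₂ : ℝ) (hα : α ≠ 0)
      (h : HasBrackets X Y Z W
        0
        (α • X + w₁ • W)
        (α • Y + w₂ • W)
        0
        0
        0)
  | g16 (β w₁ w₂ θ₁ θ₂ : ℝ) (hβ : β ≠ 0)
      (h : HasBrackets X Y Z W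
        0
        (β • Y + w₁ • W)
        (-β • X + w₂ • W)
        0
        0
        (θ₁ • Z + θ₂ • W))
  | g17 (α a w₁ w₂ : ℝ) (hα : α ≠ 0) (ha : a ≠ 0)
      (h : HasBrackets X Y Z W
        0
        (α • X + (-(a * w₁ / α)) • Z + w₁ • W)
        (α • Y + (-(a * w₂ / α)) • Z + w₂ • W)
        (a • X + (-(a ^ 2 * w₁ / α ^ 2)) • Z + (a * w₁ / α) • W)
        (a • Y + (-(a ^ 2 * w₂ / α ^ 2)) • Z + (a * w₂ / α) • W)
        0)
  | g18 (β b z₃ z₄ θ₁ θ₂ : ℝ) (hβ : β ≠ 0) (hb : b ≠ 0)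
      (h : HasBrackets X Y Z W
        0
        (β • Y + (β * z₃ / b) • Z + (-(β ^ 2 * z₃ / b ^ 2)) • W)
        (-β • X + (β * z₄ / b) • Z + (-(β ^ 2 * z₄ / b ^ 2)) • W)
        (b • Y + z₃ • Z + (-(β * z₃ / b)) • W)
        (-b • X + z₄ • Z + (-(β * z₄ / b)) • W)
        (θ₁ • Z + θ₂ • W))
  | g19 (α β w₁ w₂ : ℝ) (hα : α ≠ 0) (hβ : β ≠ 0)
      (h : HasBrackets X Y Z W
        0
        (α • X + β • Y + w₁ • W)
        (-β • X + α • Y + w₂ • W)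
        0
        0
        0)
  | g20 (α a β w₁ w₂ : ℝ) (hα : α ≠ 0) (ha : a ≠ 0) (hβ : β ≠ 0)
      (h : HasBrackets X Y Z W
        0
        (α • X + β • Y + (-(a * w₁ / α)) • Z + w₁ • W)
        (-β • X + α • Y + (-(a * w₂ / α)) • Z + w₂ • W)
        (a • X + (β * a / α) • Y + (-(a ^ 2 * w₁ / α ^ 2)) • Z + (a / α * w₁) • W)
        ((-(β * a / α)) • X + a • Y + (-(a ^ 2 * w₂ / α ^ 2)) • Z + (a / α * w₂) • W)
        0)

end

end LieGroupGeometry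

/-!
The metric and the foliation are left-invariant, so everything is decided at the identity. For
left-invariant fields the inner products are constant, and Koszul's formula expresses the
Levi-Civita connection through brackets alone
(`inner_leviCivita_mulInvariantVectorField`). In an orthonormal frame `X, Y, Z, W` with `Z, W`
tangent to the leaves, the hypotheses then become linear conditions on the structure constants:
involutivity says that `[W, Z]` is vertical, conformality says that `ad Z` and `ad W` act on the
horizontal plane as complex numbers `α + iβ` and `a + ib`, and minimality says that `ad X` and
`ad Y` are trace-free on the vertical plane. This is the bracket shape `HasFrameBrackets`
(`IsAdaptedFrame.exists_hasFrameBrackets`).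

What remains is algebra (`exists_frame_inFamilies`). Rotating `X, Y` makes the horizontal part of
`[Y, X]` a multiple of `X`; rotating `Z, W` makes `[W, Z] = lam W`. The Jacobi identity is then the
list of scalar equations `JacobiRelations`, and there are four cases.

* If `lam ≠ 0`, then `a + ib = 0`, because complex numbers commute; these are `g1` to `g4`.
* If `lam = 0` and `α + iβ`, `a + ib` are linearly independent over `ℝ`, the equations determine
  all other constants from these two numbers and `r`; these are `g5` and `g10`.
* If `lam = 0` and the two numbers are dependent, a further rotation of `Z, W` makes `a + ib = 0`.
  If `α + iβ ≠ 0`, the frame is in `g15`, `g16` or `g19`.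
* If both numbers vanish, the only relation left is `[ad Y, ad X] = r ad X` for trace-free
  endomorphisms of the vertical plane. For `r = 0` they commute (`g11` to `g14`), and for `r ≠ 0`
  the endomorphism `ad X` is nilpotent (`g6` to `g9`).

The families `g17`, `g18`, `g20` are not needed: in their frames `α + iβ` and `a + ib` are dependent,
so that rotating `Z, W` brings them to `g15`, `g16` or `g19`.
-/

namespace LieGroupGeometry

/-! ### Structure constants and rotations of the frame -/

section Algebra

/-- The brackets of `X, Y, Z, W` in a frame adapted to a conformal foliation with minimal leaves:
`Z` and `W` span a subalgebra, they act on the span of `X, Y` modulo `Z, W` as the complex numbers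
`α + iβ` and `a + ib`, and `X`, `Y` act on the span of `Z, W` modulo `X, Y` without trace. -/
def HasFrameBrackets {L : Type*} [AddCommGroup L] [Module ℝ L] [Bracket L L] (X Y Z W : L)
    (μ lam α β z₁ w₁ z₂ w₂ a b z₃ z₄ r s θ₁ θ₂ : ℝ) : Prop :=
  HasBrackets X Y Z W
    (μ • Z + lam • W)
    (α • X + β • Y + z₁ • Z + w₁ • W)
    (-β • X + α • Y + z₂ • Z + w₂ • W)
    (a • X + b • Y + z₃ • Z + -z₁ • W)
    (-b • X + a • Y + z₄ • Z + -z₂ • W)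
    (r • X + s • Y + θ₁ • Z + θ₂ • W)

variable {L : Type*} [LieRing L] [LieAlgebra ℝ L] {X Y Z W : L}
  {μ lam α β z₁ w₁ z₂ w₂ a b z₃ z₄ r s θ₁ θ₂ : ℝ}

/-- A rotation of `X, Y` commutes with `α + iβ` and `a + ib`, fixes the vertical part of `[Y, X]` and
rotates the pairs `(z₁, z₂)`, `(w₁, w₂)`, `(z₃, z₄)`, `(r, s)`. -/
theorem HasFrameBrackets.rotate_horizontal
    (h : HasFrameBrackets X Y Z W μ lam α β z₁ w₁ z₂ w₂ a b z₃ z₄ r s θ₁ θ₂)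
    {p q : ℝ} (hpq : p ^ 2 + q ^ 2 = 1) :
    HasFrameBrackets (p • X + q • Y) (-q • X + p • Y) Z W μ lam α β
      (p * z₁ + q * z₂) (p * w₁ + q * w₂) (p * z₂ - q * z₁) (p * w₂ - q * w₁) a b
      (p * z₃ + q * z₄) (p * z₄ - q * z₃) (p * r + q * s) (p * s - q * r) θ₁ θ₂ := by
  obtain ⟨h1, h2, h3, h4, h5, h6⟩ := h
  have h7 : ⁅X, Y⁆ = -(r • X + s • Y + θ₁ • Z + θ₂ • W) := by rw [← h6, lie_skew]
  refine ⟨h1, ?_, ?_, ?_, ?_, ?_⟩ <;>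
  simp only [lie_add, add_lie, lie_smul, smul_lie, lie_self, h2, h3, h4, h5, h6, h7]
  · module
  · module
  · module
  · module
  · linear_combination (norm := skip) (θ₁ * hpq) • Z + (θ₂ * hpq) • W
    module

/-- A rotation of `Z, W` rotates the pairs `(α, a)`, `(β, b)`, `(μ, lam)`, `(θ₁, θ₂)`, and conjugates
the trace-free matrices of `ad X` and `ad Y` on the vertical plane. -/
theorem HasFrameBrackets.rotate_vertical
    (h : HasFrameBrackets X Y Z W μ lam α β z₁ w₁ z₂ w₂ a b z₃ z₄ r s θ₁ θ₂)
    {p q : ℝ} (hpq : p ^ 2 + q ^ 2 = 1) :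
    HasFrameBrackets X Y (p • Z + q • W) (-q • Z + p • W) (p * μ + q * lam) (p * lam - q * μ)
      (p * α + q * a) (p * β + q * b)
      (p * (p * z₁ + q * z₃) + q * (p * w₁ - q * z₁))
      (p * (p * w₁ - q * z₁) - q * (p * z₁ + q * z₃))
      (p * (p * z₂ + q * z₄) + q * (p * w₂ - q * z₂))
      (p * (p * w₂ - q * z₂) - q * (p * z₂ + q * z₄))
      (p * a - q * α) (p * b - q * β)
      (p * (p * z₃ - q * z₁) - q * (p * z₁ + q * w₁))
      (p * (p * z₄ - q * z₂) - q * (p * z₂ + q * w₂))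
      r s (p * θ₁ + q * θ₂) (p * θ₂ - q * θ₁) := by
  obtain ⟨h1, h2, h3, h4, h5, h6⟩ := h
  have h7 : ⁅Z, W⁆ = -(μ • Z + lam • W) := by rw [← h1, lie_skew]
  refine ⟨?_, ?_, ?_, ?_, ?_, ?_⟩ <;>
  simp only [lie_add, add_lie, lie_smul, smul_lie, lie_self, h1, h2, h3, h4, h5, h6, h7]
  · module
  · linear_combination (norm := skip)
      -((p * z₁ + q * z₃) * hpq) • Z - ((p * w₁ - q * z₁) * hpq) • W
    module
  · linear_combination (norm := skip)
      -((p * z₂ + q * z₄) * hpq) • Z - ((p * w₂ - q * z₂) * hpq) • W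
    module
  · linear_combination (norm := skip)
      -((p * z₃ - q * z₁) * hpq) • Z + ((p * z₁ + q * w₁) * hpq) • W
    module
  · linear_combination (norm := skip)
      -((p * z₄ - q * z₂) * hpq) • Z + ((p * z₂ + q * w₂) * hpq) • W
    module
  · linear_combination (norm := skip) -(θ₁ * hpq) • Z - (θ₂ * hpq) • W
    module

/-- Comparison of coefficients in a linearly independent frame. -/
theorem coeffs_eq_zero (hli : LinearIndependent ℝ ![X, Y, Z, W]) {p q u v : ℝ}
    (h : p • X + q • Y + u • Z + v • W = 0) : p = 0 ∧ q = 0 ∧ u = 0 ∧ v = 0 := by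
  have := Fintype.linearIndependent_iff.1 hli ![p, q, u, v] (by simpa [Fin.sum_univ_four] using h)
  exact ⟨this 0, this 1, this 2, this 3⟩

/-! ### The Jacobi identity and the case distinction -/

/-- The Jacobi identity for brackets of the form `HasFrameBrackets` with `μ = s = 0`. A field such
as `zyx_W` is the coefficient of `W` in the identity for the triple `Z, Y, X`, up to sign;
equations that repeat others are left out. -/
structure JacobiRelations (lam α β z₁ w₁ z₂ w₂ a b z₃ z₄ r θ₁ θ₂ : ℝ) : Prop where
  wzx_X : lam * a = 0
  wzx_Y : lam * b = 0
  wzx_Z : (α - lam) * z₃ + β * z₄ - a * z₁ - b * z₂ = 0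
  wzx_W : -(α - lam) * z₁ - β * z₂ - a * w₁ - b * w₂ = 0
  wzy_Z : -β * z₃ + (α - lam) * z₄ + b * z₁ - a * z₂ = 0
  wzy_W : β * z₁ - (α - lam) * z₂ + b * w₁ - a * w₂ = 0
  zyx_X : r * α + z₁ * β + z₂ * α + w₁ * b + w₂ * a = 0
  zyx_Y : r * β + z₁ * α - z₂ * β + w₁ * a - w₂ * b = 0
  zyx_Z : r * z₁ - 2 * α * θ₁ - w₂ * z₃ + w₁ * z₄ = 0
  zyx_W : r * w₁ - θ₂ * lam - 2 * α * θ₂ - 2 * (z₂ * w₁ - z₁ * w₂) = 0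
  wyx_X : r * a + z₄ * α - z₂ * a + z₃ * β - z₁ * b = 0
  wyx_Y : r * b - z₄ * β + z₂ * b + z₃ * α - z₁ * a = 0
  wyx_Z : r * z₃ - 2 * a * θ₁ - 2 * (z₁ * z₄ - z₂ * z₃) = 0
  wyx_W : -r * z₁ + θ₁ * lam - 2 * a * θ₂ - z₄ * w₁ + z₃ * w₂ = 0

theorem HasFrameBrackets.jacobiRelations (hli : LinearIndependent ℝ ![X, Y, Z, W])
    (h : HasFrameBrackets X Y Z W 0 lam α β z₁ w₁ z₂ w₂ a b z₃ z₄ r 0 θ₁ θ₂) :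
    JacobiRelations lam α β z₁ w₁ z₂ w₂ a b z₃ z₄ r θ₁ θ₂ := by
  obtain ⟨h1, h2, h3, h4, h5, h6⟩ := h
  have h1' : ⁅Z, W⁆ = -((0 : ℝ) • Z + lam • W) := by rw [← h1, lie_skew]
  have h3' : ⁅Y, Z⁆ = -(-β • X + α • Y + z₂ • Z + w₂ • W) := by rw [← h3, lie_skew]
  have h5' : ⁅Y, W⁆ = -(-b • X + a • Y + z₄ • Z + -z₂ • W) := by rw [← h5, lie_skew]
  have J1 := leibniz_lie W Z X
  have J2 := leibniz_lie W Z Y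
  have J3 := leibniz_lie Z Y X
  have J4 := leibniz_lie W Y X
  simp only [lie_add, add_lie, lie_smul, smul_lie, lie_self, h1, h2, h3, h4, h5, h6,
    h1', h3', h5'] at J1 J2 J3 J4
  obtain ⟨e1, e2, e3, e4⟩ := coeffs_eq_zero hli (p := -lam * a) (q := -lam * b)
    (u := (α - lam) * z₃ + β * z₄ - a * z₁ - b * z₂)
    (v := -(α - lam) * z₁ - β * z₂ - a * w₁ - b * w₂)
    (by linear_combination (norm := module) J1)
  obtain ⟨-, -, e5, e6⟩ := coeffs_eq_zero hli (p := lam * b) (q := -lam * a)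
    (u := -β * z₃ + (α - lam) * z₄ + b * z₁ - a * z₂)
    (v := β * z₁ - (α - lam) * z₂ + b * w₁ - a * w₂)
    (by linear_combination (norm := module) J2)
  obtain ⟨e7, e8, e9, e10⟩ := coeffs_eq_zero hli
    (p := -(r * α + z₁ * β + z₂ * α + w₁ * b + w₂ * a))
    (q := r * β + z₁ * α - z₂ * β + w₁ * a - w₂ * b)
    (u := r * z₁ - 2 * α * θ₁ - w₂ * z₃ + w₁ * z₄)
    (v := r * w₁ - θ₂ * lam - 2 * α * θ₂ - 2 * (z₂ * w₁ - z₁ * w₂))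
    (by linear_combination (norm := module) J3)
  obtain ⟨e11, e12, e13, e14⟩ := coeffs_eq_zero hli
    (p := -(r * a + z₄ * α - z₂ * a + z₃ * β - z₁ * b))
    (q := r * b - z₄ * β + z₂ * b + z₃ * α - z₁ * a)
    (u := r * z₃ - 2 * a * θ₁ - 2 * (z₁ * z₄ - z₂ * z₃))
    (v := -r * z₁ + θ₁ * lam - 2 * a * θ₂ - z₄ * w₁ + z₃ * w₂)
    (by linear_combination (norm := module) J4)
  exact ⟨by linarith, by linarith, e3, e4, e5, e6, by linarith, e8, e9, e10, by linarith, e12,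
    e13, e14⟩

/-- Here `a + ib = 0`, and `lam - (α + iβ)` annihilates the vertical parts of `[W, X]` and `[W, Y]`,
so that the case `α + iβ = lam`, which gives `g4`, stands apart. -/
theorem HasFrameBrackets.inFamilies_of_lam_ne_zero
    (h : HasFrameBrackets X Y Z W 0 lam α β z₁ w₁ z₂ w₂ a b z₃ z₄ r 0 θ₁ θ₂)
    (J : JacobiRelations lam α β z₁ w₁ z₂ w₂ a b z₃ z₄ r θ₁ θ₂) (hlam : lam ≠ 0) :
    InFamilies X Y Z W := by
  obtain ⟨h1, h2, h3, h4, h5, h6⟩ := h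
  obtain ⟨e1, e2, e3, e4, e5, e6, e7, e8, e9, e10, e11, e12, e13, e14⟩ := J
  obtain rfl : a = 0 := by simpa [hlam] using e1
  obtain rfl : b = 0 := by simpa [hlam] using e2
  by_cases hA : (lam - α) ^ 2 + β ^ 2 = 0
  · obtain rfl : β = 0 := by nlinarith [sq_nonneg (lam - α), sq_nonneg β]
    obtain rfl : α = lam := by nlinarith [sq_nonneg (lam - α)]
    obtain rfl : z₁ = 0 := by simpa [hlam] using e8
    obtain rfl : z₃ = 0 := by simpa [hlam] using e12
    obtain rfl : z₄ = 0 := by simpa [hlam] using e11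
    obtain rfl : θ₁ = 0 := by simpa [hlam] using e9
    obtain rfl : r = -z₂ := by
      apply mul_left_cancel₀ hlam; linarith
    obtain rfl : θ₂ = -z₂ * w₁ / α := by
      field_simp; linarith
    refine .g4 α z₂ w₁ w₂ hlam ⟨h1.trans ?_, h2.trans ?_, h3.trans ?_, h4.trans ?_,
      h5.trans ?_, h6.trans ?_⟩ <;> module
  · obtain rfl : z₁ = 0 := by
      apply mul_left_cancel₀ hA; linear_combination (-(α - lam)) * e4 + β * e6
    obtain rfl : z₂ = 0 := by
      apply mul_left_cancel₀ hA; linear_combination (-(α - lam)) * e6 - β * e4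
    obtain rfl : z₃ = 0 := by
      apply mul_left_cancel₀ hA; linear_combination (α - lam) * e3 - β * e5
    obtain rfl : z₄ = 0 := by
      apply mul_left_cancel₀ hA; linear_combination (α - lam) * e5 + β * e3
    obtain rfl : θ₁ = 0 := by simpa [hlam] using e14
    by_cases hr : r = 0
    · subst hr
      by_cases hθ : θ₂ = 0
      · subst hθ
        refine .g2 lam α β w₁ w₂ hlam hA ⟨h1.trans ?_, h2.trans ?_, h3.trans ?_, h4.trans ?_,
          h5.trans ?_, h6.trans ?_⟩ <;> module
      · obtain rfl : lam = -2 * α := by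
          apply mul_left_cancel₀ hθ; linarith
        refine .g3 α β w₁ w₂ θ₂ (by simpa using hlam) hθ ⟨h1.trans ?_, h2.trans ?_, h3.trans ?_,
          h4.trans ?_, h5.trans ?_, h6.trans ?_⟩ <;> module
    · obtain rfl : α = 0 := by simpa [hr] using e7
      obtain rfl : β = 0 := by simpa [hr] using e8
      obtain rfl : θ₂ = r * w₁ / lam := by
        field_simp; linarith
      refine .g1 lam r w₁ w₂ hlam hr ⟨h1.trans ?_, h2.trans ?_, h3.trans ?_, h4.trans ?_,
        h5.trans ?_, h6.trans ?_⟩ <;> module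

/-- With `c = α + iβ`, `d = a + ib`, `ξ = z₁ + i z₂`, `η = z₃ + i z₄`, `ω = w₁ + i w₂` and
`D = Im (d̄ c)`, the linear Jacobi relations read `c̄ η = d̄ ξ`, `c̄ ξ = -d̄ ω`,
`c ξ + d ω = -i r c̄`, `c η - d ξ = -i r d̄`. They give
`2 D ξ = -r c̄ d̄`, `2 D ω = r c̄²`, `2 D η = -r d̄²`. -/
theorem HasFrameBrackets.inFamilies_of_det_ne_zero
    (h : HasFrameBrackets X Y Z W 0 0 α β z₁ w₁ z₂ w₂ a b z₃ z₄ r 0 θ₁ θ₂)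
    (J : JacobiRelations 0 α β z₁ w₁ z₂ w₂ a b z₃ z₄ r θ₁ θ₂) (hD : a * β - α * b ≠ 0) :
    InFamilies X Y Z W := by
  obtain ⟨h1, h2, h3, h4, h5, h6⟩ := h
  obtain ⟨-, -, e3, e4, e5, e6, e7, e8, e9, e10, e11, e12, e13, e14⟩ := J
  obtain ⟨D, hDdef⟩ : ∃ D, a * β - α * b = D := ⟨_, rfl⟩
  rw [hDdef] at hD
  have hz₁ : z₁ = r * (β * b - α * a) / (2 * D) := by
    field_simp; linear_combination a * e7 - b * e8 + a * e6 + b * e4 - 2 * z₁ * hDdef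
  have hz₂ : z₂ = r * (α * b + β * a) / (2 * D) := by
    field_simp; linear_combination -(a * e8 + b * e7 + a * e4 - b * e6) - 2 * z₂ * hDdef
  have hw₁ : w₁ = r * (α ^ 2 - β ^ 2) / (2 * D) := by
    field_simp; linear_combination -(α * e7 - β * e8 + α * e6 + β * e4) - 2 * w₁ * hDdef
  have hw₂ : w₂ = -(r * α * β / D) := by
    field_simp; linear_combination (α * e8 + β * e7 + α * e4 - β * e6) / 2 - w₂ * hDdef
  have hz₃ : z₃ = r * (b ^ 2 - a ^ 2) / (2 * D) := by
    field_simp; linear_combination a * e11 - b * e12 - a * e5 - b * e3 - 2 * z₃ * hDdef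
  have hz₄ : z₄ = r * a * b / D := by
    field_simp; linear_combination -(a * e12 + b * e11 - a * e3 + b * e5) / 2 - z₄ * hDdef
  have hαa : α ≠ 0 ∨ a ≠ 0 := by
    by_contra! hc; apply hD; rw [← hDdef, hc.1, hc.2]; ring
  have hθ₁ : θ₁ = -(a * r ^ 2 / (2 * D)) := by
    rcases hαa with hα | ha
    · have : θ₁ = (r * z₁ - w₂ * z₃ + w₁ * z₄) / (2 * α) := by field_simp; linarith
      rw [this, hz₁, hw₂, hz₃, hw₁, hz₄]; field_simp; rw [← hDdef]; ring
    · have : θ₁ = (r * z₃ - 2 * (z₁ * z₄ - z₂ * z₃)) / (2 * a) := by field_simp; linarith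
      rw [this, hz₁, hz₂, hz₃, hz₄]; field_simp; rw [← hDdef]; ring
  have hθ₂ : θ₂ = α * r ^ 2 / (2 * D) := by
    rcases hαa with hα | ha
    · have : θ₂ = (r * w₁ - 2 * (z₂ * w₁ - z₁ * w₂)) / (2 * α) := by field_simp; linarith
      rw [this, hz₁, hz₂, hw₁, hw₂]; field_simp; rw [← hDdef]; ring
    · have : θ₂ = (-r * z₁ - z₄ * w₁ + z₃ * w₂) / (2 * a) := by field_simp; linarith
      rw [this, hz₁, hw₂, hz₃, hw₁, hz₄]; field_simp; rw [← hDdef]; ring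
  by_cases hr : r = 0
  · subst hr
    simp only [zero_mul, zero_div, neg_zero, mul_zero, ne_eq, OfNat.ofNat_ne_zero,
      not_false_eq_true, zero_pow] at hz₁ hz₂ hw₁ hw₂ hz₃ hz₄ hθ₁ hθ₂
    subst z₁ z₂ w₁ w₂ z₃ z₄ θ₁ θ₂
    refine .g10 α a β b (fun hc => hD (by linarith)) ⟨h1.trans ?_, h2.trans ?_, h3.trans ?_,
      h4.trans ?_, h5.trans ?_, h6.trans ?_⟩ <;> module
  · have hz₁' : -z₁ = r * (α * a - β * b) / (2 * D) := by rw [hz₁]; ring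
    refine .g5 α a β b r hr (hDdef ▸ hD) ?_
    rw [hDdef, ← hz₁, ← hz₂, ← hz₁', ← hw₁, ← hw₂, ← hz₃, ← hz₄, ← hθ₁, ← hθ₂]
    exact ⟨h1.trans (by module), h2, h3, h4, h5, h6.trans (by module)⟩

/-- Here `ad W` vanishes on the horizontal plane and `ad Z` does not; the invertibility of `α + iβ`
kills `z₁, z₂, z₃, z₄` and `r`. -/
theorem HasFrameBrackets.inFamilies_of_action_ne_zero
    (h : HasFrameBrackets X Y Z W 0 0 α β z₁ w₁ z₂ w₂ 0 0 z₃ z₄ r 0 θ₁ θ₂)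
    (J : JacobiRelations 0 α β z₁ w₁ z₂ w₂ 0 0 z₃ z₄ r θ₁ θ₂) (hc : α ^ 2 + β ^ 2 ≠ 0) :
    InFamilies X Y Z W := by
  obtain ⟨h1, h2, h3, h4, h5, h6⟩ := h
  obtain ⟨-, -, e3, e4, e5, e6, e7, e8, e9, e10, -, -, -, -⟩ := J
  obtain rfl : z₁ = 0 := by
    apply mul_left_cancel₀ hc; linear_combination -α * e4 + β * e6
  obtain rfl : z₂ = 0 := by
    apply mul_left_cancel₀ hc; linear_combination -α * e6 - β * e4
  obtain rfl : z₃ = 0 := by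
    apply mul_left_cancel₀ hc; linear_combination α * e3 - β * e5
  obtain rfl : z₄ = 0 := by
    apply mul_left_cancel₀ hc; linear_combination α * e5 + β * e3
  obtain rfl : r = 0 := by
    apply mul_left_cancel₀ hc; linear_combination α * e7 + β * e8
  by_cases hα : α = 0
  · subst hα
    refine .g16 β w₁ w₂ θ₁ θ₂ (by simpa using hc) ⟨h1.trans ?_, h2.trans ?_, h3.trans ?_,
      h4.trans ?_, h5.trans ?_, h6.trans ?_⟩ <;> module
  · obtain rfl : θ₁ = 0 := by simpa [hα] using e9
    obtain rfl : θ₂ = 0 := by simpa [hα] using e10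
    by_cases hβ : β = 0
    · subst hβ
      refine .g15 α w₁ w₂ hα ⟨h1.trans ?_, h2.trans ?_, h3.trans ?_,
        h4.trans ?_, h5.trans ?_, h6.trans ?_⟩ <;> module
    · refine .g19 α β w₁ w₂ hα hβ ⟨h1.trans ?_, h2.trans ?_, h3.trans ?_,
        h4.trans ?_, h5.trans ?_, h6.trans ?_⟩ <;> module

theorem HasFrameBrackets.inFamilies_of_trivial_action
    (h : HasFrameBrackets X Y Z W 0 0 0 0 z₁ w₁ z₂ w₂ 0 0 z₃ z₄ r 0 θ₁ θ₂)
    (J : JacobiRelations 0 0 0 z₁ w₁ z₂ w₂ 0 0 z₃ z₄ r θ₁ θ₂) :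
    InFamilies X Y Z W := by
  obtain ⟨h1, h2, h3, h4, h5, h6⟩ := h
  obtain ⟨-, -, -, -, -, -, -, -, e9, e10, -, -, e13, -⟩ := J
  simp only [mul_zero, zero_mul, sub_zero] at e9 e10 e13
  by_cases hr : r = 0
  · subst hr
    by_cases hz₁ : z₁ = 0
    · subst hz₁
      by_cases hw₁ : w₁ = 0
      · subst hw₁
        by_cases hz₃ : z₃ = 0
        · subst hz₃
          refine .g14 z₂ z₄ w₂ θ₁ θ₂ ⟨h1.trans ?_, h2.trans ?_, h3.trans ?_,
            h4.trans ?_, h5.trans ?_, h6.trans ?_⟩ <;> module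
        · obtain rfl : z₂ = 0 := by simpa [hz₃] using e13
          obtain rfl : w₂ = 0 := by simpa [hz₃] using e9
          refine .g13 z₃ z₄ θ₁ θ₂ hz₃ ⟨h1.trans ?_, h2.trans ?_, h3.trans ?_,
            h4.trans ?_, h5.trans ?_, h6.trans ?_⟩ <;> module
      · obtain rfl : z₂ = 0 := by simpa [hw₁] using e10
        obtain rfl : z₄ = z₃ * w₂ / w₁ := by field_simp; linarith
        refine .g12 z₃ w₁ w₂ θ₁ θ₂ hw₁ ⟨h1.trans ?_, h2.trans ?_, h3.trans ?_,
          h4.trans ?_, h5.trans ?_, h6.trans ?_⟩ <;> module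
    · obtain rfl : z₄ = z₂ * z₃ / z₁ := by field_simp; linarith
      obtain rfl : w₂ = z₂ * w₁ / z₁ := by field_simp; linarith
      refine .g11 z₁ z₂ z₃ w₁ θ₁ θ₂ hz₁ ⟨h1.trans ?_, h2.trans ?_, h3.trans ?_,
        h4.trans ?_, h5.trans ?_, h6.trans ?_⟩ <;> module
  -- `[ad Y, ad X] = r ad X` on the vertical plane, so that `ad X` is nilpotent there; as it is
  -- trace-free, this means that its determinant `-(z₁ ^ 2 + z₃ * w₁)` vanishes.
  · have hnil : z₁ ^ 2 + z₃ * w₁ = 0 := by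
      apply mul_left_cancel₀ hr; linear_combination z₁ * e9 + (z₃ * e10 + w₁ * e13) / 2
    by_cases hz₁ : z₁ = 0
    · subst hz₁
      have hzw : z₃ = 0 ∨ w₁ = 0 := by simpa using hnil
      by_cases hw₁ : w₁ = 0
      · subst hw₁
        by_cases hz₃ : z₃ = 0
        · subst hz₃
          refine .g8 z₂ z₄ w₂ r θ₁ θ₂ hr ⟨h1.trans ?_, h2.trans ?_, h3.trans ?_,
            h4.trans ?_, h5.trans ?_, h6.trans ?_⟩ <;> module
        · obtain rfl : r = -2 * z₂ := by
            apply mul_left_cancel₀ hz₃; linarith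
          obtain rfl : w₂ = 0 := by simpa [hz₃] using e9
          refine .g9 z₂ z₃ z₄ θ₁ θ₂ (by simpa using hr) ⟨h1.trans ?_, h2.trans ?_, h3.trans ?_,
            h4.trans ?_, h5.trans ?_, h6.trans ?_⟩ <;> module
      · obtain rfl : z₃ = 0 := by simpa [hw₁] using hzw
        obtain rfl : r = 2 * z₂ := by
          apply mul_left_cancel₀ hw₁; linarith
        obtain rfl : z₄ = 0 := by simpa [hw₁] using e9
        refine .g7 z₂ w₁ w₂ θ₁ θ₂ (by simpa using hr) hw₁ ⟨h1.trans ?_, h2.trans ?_,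
          h3.trans ?_, h4.trans ?_, h5.trans ?_, h6.trans ?_⟩ <;> module
    · have hz₃ : z₃ ≠ 0 := by
        rintro rfl; apply hz₁; simpa using hnil
      have hw₂ : z₃ * 2 * w₂ = z₁ * (r - 2 * z₂) :=
        mul_left_cancel₀ hz₁ (by linear_combination z₃ * e10 - (r - 2 * z₂) * hnil)
      obtain rfl : w₂ = z₁ * (r - 2 * z₂) / (2 * z₃) := by field_simp; linarith
      obtain rfl : z₄ = z₃ * (r + 2 * z₂) / (2 * z₁) := by field_simp; linarith
      obtain rfl : w₁ = -(z₁ ^ 2 / z₃) := by field_simp; linarith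
      refine .g6 z₁ z₂ z₃ r θ₁ θ₂ hr hz₁ hz₃ ⟨h1.trans ?_, h2.trans ?_, h3.trans ?_,
        h4.trans ?_, h5.trans ?_, h6.trans ?_⟩ <;> module

/-- There is a unit vector `(p, q)` parallel to `(y, x)`. -/
theorem exists_rotation (x y : ℝ) : ∃ p q : ℝ, p ^ 2 + q ^ 2 = 1 ∧ p * x = q * y := by
  by_cases h : x ^ 2 + y ^ 2 = 0
  · refine ⟨1, 0, by norm_num, ?_⟩
    have : x = 0 := by nlinarith [sq_nonneg x, sq_nonneg y]
    simp [this]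
  · have hpos : 0 < x ^ 2 + y ^ 2 := by positivity
    have hn : √(x ^ 2 + y ^ 2) ≠ 0 := (Real.sqrt_pos.2 hpos).ne'
    refine ⟨y / √(x ^ 2 + y ^ 2), x / √(x ^ 2 + y ^ 2), ?_, by ring⟩
    rw [div_pow, div_pow, Real.sq_sqrt hpos.le]
    field_simp
    ring

/-- If two complex numbers `α + iβ`, `a + ib` are dependent over `ℝ`, some rotation of the pair
makes the second one vanish. -/
theorem exists_rotation_of_det_eq_zero {α β a b : ℝ} (h : a * β - α * b = 0) :
    ∃ p q : ℝ, p ^ 2 + q ^ 2 = 1 ∧ p * a = q * α ∧ p * b = q * β := by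
  by_cases h0 : a = 0 ∧ α = 0
  · obtain ⟨p, q, h1, h2⟩ := exists_rotation b β
    exact ⟨p, q, h1, by simp [h0.1, h0.2], h2⟩
  · obtain ⟨p, q, h1, h2⟩ := exists_rotation a α
    refine ⟨p, q, h1, h2, ?_⟩
    have h3 : α * (p * b - q * β) = 0 := by linear_combination -p * h + β * h2
    have h4 : a * (p * b - q * β) = 0 := by linear_combination b * h2 - q * h
    by_cases hα : α = 0
    · have ha : a ≠ 0 := fun ha => h0 ⟨ha, hα⟩
      have := (mul_eq_zero.1 h4).resolve_left ha
      linarith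
    · have := (mul_eq_zero.1 h3).resolve_left hα
      linarith

/-- The algebraic classification: in a class `P` of frames that is stable under rotations of `X, Y`
and of `Z, W`, a frame whose brackets have the adapted form can be rotated into the families. -/
theorem exists_frame_inFamilies {P : L → L → L → L → Prop}
    (hind : ∀ {X Y Z W}, P X Y Z W → LinearIndependent ℝ ![X, Y, Z, W])
    (hhor : ∀ {X Y Z W} {p q : ℝ}, p ^ 2 + q ^ 2 = 1 → P X Y Z W →
      P (p • X + q • Y) (-q • X + p • Y) Z W)
    (hver : ∀ {X Y Z W} {p q : ℝ}, p ^ 2 + q ^ 2 = 1 → P X Y Z W →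
      P X Y (p • Z + q • W) (-q • Z + p • W))
    {μ s : ℝ} (hP : P X Y Z W)
    (h : HasFrameBrackets X Y Z W μ lam α β z₁ w₁ z₂ w₂ a b z₃ z₄ r s θ₁ θ₂) :
    ∃ X Y Z W, P X Y Z W ∧ InFamilies X Y Z W := by
  -- The first rotation makes `s = 0`, the second one `μ = 0`.
  obtain ⟨p, q, hpq, hs⟩ := exists_rotation s r
  obtain ⟨p', q', hpq', hμ⟩ := exists_rotation μ (-lam)
  have hP2 := hver hpq' (hhor hpq hP)
  have h2 := (h.rotate_horizontal hpq).rotate_vertical hpq'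
  rw [hs, sub_self, hμ, show q' * -lam + q' * lam = 0 by ring] at h2
  have J := h2.jacobiRelations (hind hP2)
  generalize p' * lam - q' * μ = lam' at h2 J
  by_cases hlam : lam' = 0
  · subst hlam
    by_cases hD : (p' * a - q' * α) * (p' * β + q' * b) - (p' * α + q' * a) * (p' * b - q' * β) = 0
    -- A third rotation makes `a = b = 0`; it keeps `s = 0` and the abelian leaf algebra.
    · obtain ⟨p'', q'', hpq'', h3, h4⟩ := exists_rotation_of_det_eq_zero hD
      have hP3 := hver hpq'' hP2
      have h5 := h2.rotate_vertical hpq''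
      rw [h3, h4, sub_self, sub_self, mul_zero, mul_zero, add_zero, sub_self] at h5
      have J := h5.jacobiRelations (hind hP3)
      refine ⟨_, _, _, _, hP3, ?_⟩
      revert h5 J
      generalize p'' * (p' * α + q' * a) + q'' * (p' * a - q' * α) = α'
      generalize p'' * (p' * β + q' * b) + q'' * (p' * b - q' * β) = β'
      intro h5 J
      by_cases hc : α' ^ 2 + β' ^ 2 = 0
      · obtain rfl : α' = 0 := by nlinarith [sq_nonneg α', sq_nonneg β']
        obtain rfl : β' = 0 := by nlinarith [sq_nonneg β']
        exact h5.inFamilies_of_trivial_action J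
      · exact h5.inFamilies_of_action_ne_zero J hc
    · exact ⟨_, _, _, _, hP2, h2.inFamilies_of_det_ne_zero J hD⟩
  · exact ⟨_, _, _, _, hP2, h2.inFamilies_of_lam_ne_zero J hlam⟩

end Algebra

/-! ### Orthonormal frames of four vectors -/

section InnerProduct

variable {F : Type*} [NormedAddCommGroup F] [InnerProductSpace ℝ F] {X Y Z W : F}

theorem orthonormal_four_iff : Orthonormal ℝ ![X, Y, Z, W] ↔
    (inner ℝ X X = 1 ∧ inner ℝ Y Y = 1 ∧ inner ℝ Z Z = 1 ∧ inner ℝ W W = 1) ∧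
    (inner ℝ X Y = 0 ∧ inner ℝ X Z = 0 ∧ inner ℝ X W = 0 ∧ inner ℝ Y Z = 0 ∧ inner ℝ Y W = 0 ∧
      inner ℝ Z W = 0) := by
  simp only [orthonormal_iff_ite, Fin.forall_fin_succ, Matrix.cons_val_zero, Matrix.cons_val_succ,
    IsEmpty.forall_iff, and_true]
  simp [Fin.ext_iff, real_inner_comm X, real_inner_comm Y Z, real_inner_comm Y W,
    real_inner_comm Z W]
  tauto

theorem orthonormal_rotate_horizontal (h : Orthonormal ℝ ![X, Y, Z, W]) {p q : ℝ}
    (hpq : p ^ 2 + q ^ 2 = 1) : Orthonormal ℝ ![p • X + q • Y, -q • X + p • Y, Z, W] := by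
  rw [orthonormal_four_iff] at h ⊢
  obtain ⟨⟨h1, h2, h3, h4⟩, h5, h6, h7, h8, h9, h10⟩ := h
  simp only [inner_add_left, inner_add_right, real_inner_smul_left, real_inner_smul_right,
    real_inner_comm X Y, h1, h2, h3, h4, h5, h6, h7, h8, h9, h10]
  refine ⟨⟨?_, ?_, ?_, ?_⟩, ?_, ?_, ?_, ?_, ?_, ?_⟩ <;> first | trivial | linarith

theorem orthonormal_rotate_vertical (h : Orthonormal ℝ ![X, Y, Z, W]) {p q : ℝ}
    (hpq : p ^ 2 + q ^ 2 = 1) : Orthonormal ℝ ![X, Y, p • Z + q • W, -q • Z + p • W] := by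
  rw [orthonormal_four_iff] at h ⊢
  obtain ⟨⟨h1, h2, h3, h4⟩, h5, h6, h7, h8, h9, h10⟩ := h
  simp only [inner_add_left, inner_add_right, real_inner_smul_left, real_inner_smul_right,
    real_inner_comm Z W, h1, h2, h3, h4, h5, h6, h7, h8, h9, h10]
  refine ⟨⟨?_, ?_, ?_, ?_⟩, ?_, ?_, ?_, ?_, ?_, ?_⟩ <;> first | trivial | linarith

theorem eq_sum_of_orthonormal (hF : Module.finrank ℝ F = 4) (h : Orthonormal ℝ ![X, Y, Z, W])
    (v : F) : v = (inner ℝ v X : ℝ) • X + (inner ℝ v Y : ℝ) • Y + (inner ℝ v Z : ℝ) • Z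
      + (inner ℝ v W : ℝ) • W := by
  have : FiniteDimensional ℝ F := .of_finrank_pos (by omega)
  let b := basisOfOrthonormalOfCardEqFinrank h (by simp [hF])
  have hb : ⇑b = ![X, Y, Z, W] := coe_basisOfOrthonormalOfCardEqFinrank ..
  let o := b.toOrthonormalBasis (by rwa [hb])
  have := o.sum_repr' v
  simp only [o, Module.Basis.coe_toOrthonormalBasis, hb, Fin.sum_univ_four] at this
  simpa [real_inner_comm v] using this.symm

theorem finrank_span_pair_of_orthonormal (h : Orthonormal ℝ ![X, Y, Z, W]) :
    Module.finrank ℝ (Submodule.span ℝ {Z, W}) = 2 := by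
  have hli : LinearIndependent ℝ ![Z, W] := by
    have h' := h.linearIndependent.comp (![2, 3] : Fin 2 → Fin 4) (by decide)
    rwa [show ![X, Y, Z, W] ∘ (![2, 3] : Fin 2 → Fin 4) = ![Z, W] by
      ext i; fin_cases i <;> rfl] at h'
  have hr : Set.range ![Z, W] = {Z, W} := by
    rw [Matrix.range_cons, Matrix.range_cons, Matrix.range_empty, Set.union_empty,
      Set.singleton_union]
  rw [← hr, finrank_span_eq_card hli, Fintype.card_fin]

theorem exists_orthonormal_of_finrank (hF : Module.finrank ℝ F = 4) {K : Submodule ℝ F}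
    (hK : Module.finrank ℝ K = 2) :
    ∃ X Y Z W : F, Orthonormal ℝ ![X, Y, Z, W] ∧ Z ∈ K ∧ W ∈ K := by
  have : FiniteDimensional ℝ F := .of_finrank_pos (by omega)
  have hK' : Module.finrank ℝ Kᗮ = 2 := by
    have := K.finrank_add_finrank_orthogonal; omega
  let b := (stdOrthonormalBasis ℝ K).reindex (finCongr hK)
  let c := (stdOrthonormalBasis ℝ Kᗮ).reindex (finCongr hK')
  have hbn := orthonormal_iff_ite.1 b.orthonormal
  have hcn := orthonormal_iff_ite.1 c.orthonormal
  have hcb : ∀ i j, inner ℝ (c i : F) (b j : F) = 0 := fun i j =>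
    Submodule.inner_left_of_mem_orthogonal (b j).2 (c i).2
  refine ⟨c 0, c 1, b 0, b 1, orthonormal_four_iff.2 ⟨⟨?_, ?_, ?_, ?_⟩, ?_, hcb _ _, hcb _ _,
    hcb _ _, hcb _ _, ?_⟩, (b 0).2, (b 1).2⟩
  · exact hcn 0 0
  · exact hcn 1 1
  · exact hbn 0 0
  · exact hbn 1 1
  · exact hcn 0 1
  · exact hbn 0 1

end InnerProduct

/-! ### Left-invariant vector fields -/

section Invariant

open Bundle VectorField Module

variable {E : Type*} [NormedAddCommGroup E] [NormedSpace ℝ E]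
  {H : Type*} [TopologicalSpace H] {I : ModelWithCorners ℝ E H}
  {G : Type*} [TopologicalSpace G] [ChartedSpace H G] [Group G] [LieGroup I ∞ G]

/-- This is the smoothness under which Mathlib makes `GroupLieAlgebra I G` a Lie algebra. -/
theorem lieGroup_minSmoothness : LieGroup I (minSmoothness ℝ 3) G :=
  LieGroup.of_le (n := ∞) (by simp; norm_cast)

theorem bracket_swap {G : Type*} [TopologicalSpace G] [ChartedSpace H G] [Group G]
    (v w : GroupLieAlgebra I G) : ⁅v, w⁆ = -⁅w, v⁆ :=
  mlieBracket_swap_apply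

/-- Left-invariant vector fields are smooth. The field is the composition of the derivative of the
multiplication with `g ↦ (0, v)`, a section of the tangent bundle of `G × G` along `G × {1}`;
this is the argument for `contMDiff_mulInvariantVectorField`, which gives finite smoothness. -/
theorem contMDiff_infty_mulInvariantVectorField (v : GroupLieAlgebra I G) :
    CMDiff ∞ (fun g : G => (mulInvariantVectorField v g : TangentBundle I G)) := by
  let fg : G → TangentBundle I G := fun g ↦ TotalSpace.mk' E g 0
  have sfg : CMDiff ∞ fg := contMDiff_zeroSection _ _
  let fv : G → TangentBundle I G := fun _ ↦ TotalSpace.mk' E 1 v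
  have sfv : CMDiff ∞ fv := contMDiff_const
  let F₁ : G → (TangentBundle I G × TangentBundle I G) := fun g ↦ (fg g, fv g)
  have S₁ : CMDiff ∞ F₁ := sfg.prodMk sfv
  let F₂ : (TangentBundle I G × TangentBundle I G) → TangentBundle (I.prod I) (G × G) :=
    (equivTangentBundleProd I G I G).symm
  have S₂ : CMDiff ∞ F₂ := contMDiff_equivTangentBundleProd_symm
  let F₃ : TangentBundle (I.prod I) (G × G) → TangentBundle I G :=
    tangentMap% (fun (p : G × G) ↦ p.1 * p.2)
  have S₃ : CMDiff ∞ F₃ :=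
    (contMDiff_mul I ∞).contMDiff_tangentMap (m := ∞) le_rfl
  let S := (S₃.comp S₂).comp S₁
  convert! S with g
  · simp [F₁, F₂, F₃, fg, fv]
  · simp only [Function.comp_apply, tangentMap, F₃, F₂, F₁, fg, fv]
    rw [mfderiv_prod_eq_add_apply ((contMDiff_mul I ∞).mdifferentiableAt (by simp))]
    have hadd : ∀ (A B : E →L[ℝ] E), B v = A 0 + B v := fun A B => by rw [map_zero, zero_add]
    exact hadd _ _

theorem mulInvariantVectorField_one (v : GroupLieAlgebra I G) :
    mulInvariantVectorField v (1 : G) = v := by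
  have key : ∀ f : G → G, f = id → (mfderiv I I f (1 : G) v : E) = v := by
    rintro _ rfl
    rw [mfderiv_id]
    rfl
  exact key _ (funext one_mul)

theorem mulInvariantVectorField_mem_iff {𝒱 : Π x : G, Submodule ℝ (TangentSpace I x)}
    (h𝒱 : IsLeftInvariant 𝒱) (v : GroupLieAlgebra I G) (g : G) :
    mulInvariantVectorField v g ∈ 𝒱 g ↔ v ∈ 𝒱 1 := by
  -- `mulInvariantVectorField v g` is by definition a tangent vector at `g * 1`.
  have key : ∀ k : G, k = g → ∀ u : E, (u : TangentSpace I k) ∈ 𝒱 k ↔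
      (u : TangentSpace I g) ∈ 𝒱 g := by
    rintro _ rfl u; rfl
  exact (key _ (mul_one g) _).symm.trans (h𝒱 g 1 v).symm

variable [RiemannianBundle (fun x : G => TangentSpace I x)]

theorem inner_mulInvariantVectorField (hmetric : IsLeftInvariantMetric I G)
    (v w : GroupLieAlgebra I G) (g : G) :
    (inner ℝ (mulInvariantVectorField v g) (mulInvariantVectorField w g) : ℝ) =
      inner ℝ (E := TangentSpace I (1 : G)) v w := by
  have key : ∀ k : G, k = g → ∀ u u' : E,
      (inner ℝ (E := TangentSpace I g) u u' : ℝ) = inner ℝ (E := TangentSpace I k) u u' := by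
    rintro _ rfl u u'; rfl
  exact (key _ (mul_one g) _ _).trans (hmetric g 1 v w)

end Invariant

/-! ### Left-invariant sections and the second fundamental forms -/

section Frame

open Bundle VectorField Module Foliation

variable {E : Type*} [NormedAddCommGroup E] [NormedSpace ℝ E]
  {H : Type*} [TopologicalSpace H] {I : ModelWithCorners ℝ E H}
  {G : Type*} [TopologicalSpace G] [ChartedSpace H G] [Group G] [LieGroup I ∞ G]
  {𝒱 : Π x : G, Submodule ℝ (TangentSpace I x)}

theorem isSectionNear_mulInvariantVectorField (h𝒱 : IsLeftInvariant 𝒱)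
    {v : GroupLieAlgebra I G} (hv : v ∈ 𝒱 1) (g : G) :
    IsSectionNear 𝒱 (mulInvariantVectorField v) g :=
  .of_forall fun y => ⟨contMDiff_infty_mulInvariantVectorField v y,
    (mulInvariantVectorField_mem_iff h𝒱 v y).2 hv⟩

variable [RiemannianBundle (fun x : G => TangentSpace I x)] {X Y Z W : GroupLieAlgebra I G}

theorem orthonormal_mulInvariantVectorField (hmetric : IsLeftInvariantMetric I G)
    (h : Orthonormal ℝ (E := TangentSpace I (1 : G)) ![X, Y, Z, W]) (g : G) :
    Orthonormal ℝ ![mulInvariantVectorField X g, mulInvariantVectorField Y g,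
      mulInvariantVectorField Z g, mulInvariantVectorField W g] := by
  rw [orthonormal_four_iff] at h ⊢
  simpa only [inner_mulInvariantVectorField hmetric] using h

theorem isAdaptedFrame_of_mem [FiniteDimensional ℝ E] (hmetric : IsLeftInvariantMetric I G)
    (h𝒱 : IsLeftInvariant 𝒱) (hrank : ∀ g, finrank ℝ (𝒱 g) = 2)
    (h : Orthonormal ℝ (E := TangentSpace I (1 : G)) ![X, Y, Z, W])
    (hZ : Z ∈ 𝒱 1) (hW : W ∈ 𝒱 1) : IsAdaptedFrame 𝒱 X Y Z W := by
  refine ⟨h, fun g => ?_⟩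
  have := LeviCivita.finiteDimensional_tangentSpace (I := I) g
  symm
  refine Submodule.eq_of_le_of_finrank_eq ?_ ?_
  · rw [Submodule.span_le]
    rintro _ (rfl | rfl)
    · exact (mulInvariantVectorField_mem_iff h𝒱 Z g).2 hZ
    · exact (mulInvariantVectorField_mem_iff h𝒱 W g).2 hW
  · rw [hrank]
    exact finrank_span_pair_of_orthonormal (orthonormal_mulInvariantVectorField hmetric h g)

/-- Orthogonality to `Z, W` at the identity propagates by the invariance of the metric. -/
theorem isSectionNear_horizontal (hmetric : IsLeftInvariantMetric I G)
    (h : IsAdaptedFrame 𝒱 X Y Z W) {v : GroupLieAlgebra I G}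
    (hvZ : inner ℝ (E := TangentSpace I (1 : G)) Z v = 0)
    (hvW : inner ℝ (E := TangentSpace I (1 : G)) W v = 0) (g : G) :
    IsSectionNear (horizontal 𝒱) (mulInvariantVectorField v) g := by
  refine .of_forall fun y => ⟨contMDiff_infty_mulInvariantVectorField v y, ?_⟩
  rw [horizontal, h.2 y, Submodule.mem_orthogonal]
  intro u hu
  obtain ⟨p, q, rfl⟩ := Submodule.mem_span_pair.1 hu
  rw [inner_add_left, real_inner_smul_left, real_inner_smul_left,
    inner_mulInvariantVectorField hmetric, inner_mulInvariantVectorField hmetric, hvZ, hvW]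
  simp

variable [FiniteDimensional ℝ E] [CompleteSpace E]
  [IsContMDiffRiemannianBundle I ∞ E (fun x : G => TangentSpace I x)]

/-- Koszul's formula for left-invariant fields, whose inner products are constant. -/
theorem inner_leviCivita_mulInvariantVectorField (hmetric : IsLeftInvariantMetric I G)
    (A B C : GroupLieAlgebra I G) :
    inner ℝ (E := TangentSpace I (1 : G)) (LeviCivita.leviCivita I G (mulInvariantVectorField B) 1
      (mulInvariantVectorField A 1)) C = (1 / 2) * (inner ℝ (E := TangentSpace I (1 : G)) ⁅A, B⁆ C
        - inner ℝ (E := TangentSpace I (1 : G)) ⁅A, C⁆ B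
        - inner ℝ (E := TangentSpace I (1 : G)) ⁅B, C⁆ A) := by
  have hd : ∀ v : GroupLieAlgebra I G, MDiffAt (T% (mulInvariantVectorField v)) (1 : G) := fun v =>
    (contMDiff_infty_mulInvariantVectorField v 1).mdifferentiableAt (by simp)
  have h1 := LeviCivita.inner_conn (hd A) (hd B) (hd C)
  change inner ℝ (LeviCivita.leviCivita I G (mulInvariantVectorField B) 1
      (mulInvariantVectorField A 1)) (mulInvariantVectorField C 1) = _ at h1
  have hc : ∀ v w : GroupLieAlgebra I G,
      (fun y : G => (inner ℝ (mulInvariantVectorField v y) (mulInvariantVectorField w y) : ℝ))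
        = fun _ => inner ℝ (E := TangentSpace I (1 : G)) v w :=
    fun v w => funext fun y => inner_mulInvariantVectorField hmetric v w y
  simp only [LeviCivita.koszul, hc, mulInvariantVectorField_one] at h1
  rw [mulInvariantVectorField_one, h1]
  simp [GroupLieAlgebra.bracket_def, mvfderiv_const]

theorem inner_secondForm_of_mem {x : G} {𝒲 : Π x : G, Submodule ℝ (TangentSpace I x)}
    (U V : Π x : G, TangentSpace I x)
    {c : TangentSpace I x} (hc : c ∈ horizontal 𝒲 x) :
    (inner ℝ (secondForm 𝒲 U V x) c : ℝ) = (1 / 2) *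
      (inner ℝ (LeviCivita.leviCivita I G V x (U x)) c +
        inner ℝ (LeviCivita.leviCivita I G U x (V x)) c) := by
  have := LeviCivita.finiteDimensional_tangentSpace (I := I) x
  rw [secondForm, real_inner_smul_left, proj, Submodule.inner_starProjection_left_eq_right,
    Submodule.starProjection_eq_self_iff.2 hc, inner_add_left]

theorem inner_secondForm_mulInvariantVectorField (hmetric : IsLeftInvariantMetric I G)
    {𝒲 : Π x : G, Submodule ℝ (TangentSpace I x)}
    (A B : GroupLieAlgebra I G) {C : GroupLieAlgebra I G} (hC : C ∈ horizontal 𝒲 1) :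
    inner ℝ (E := TangentSpace I (1 : G))
      (secondForm 𝒲 (mulInvariantVectorField A) (mulInvariantVectorField B) 1) C =
    (1 / 2) * (inner ℝ (E := TangentSpace I (1 : G)) ⁅C, A⁆ B +
      inner ℝ (E := TangentSpace I (1 : G)) ⁅C, B⁆ A) := by
  rw [inner_secondForm_of_mem _ _ hC, inner_leviCivita_mulInvariantVectorField hmetric,
    inner_leviCivita_mulInvariantVectorField hmetric, bracket_swap A B, bracket_swap A C,
    bracket_swap B C, inner_neg_left, inner_neg_left, inner_neg_left]
  ring

end Frame

/-! ### The brackets of an adapted frame -/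

section FrameBrackets

open Bundle VectorField Module Foliation

variable {E : Type*} [NormedAddCommGroup E] [NormedSpace ℝ E] [FiniteDimensional ℝ E]
  [CompleteSpace E]
  {H : Type*} [TopologicalSpace H] {I : ModelWithCorners ℝ E H}
  {G : Type*} [TopologicalSpace G] [ChartedSpace H G] [Group G] [LieGroup I ∞ G]
  {𝒱 : Π x : G, Submodule ℝ (TangentSpace I x)}
  [RiemannianBundle (fun x : G => TangentSpace I x)]
  [IsContMDiffRiemannianBundle I ∞ E (fun x : G => TangentSpace I x)]
  {X Y Z W : GroupLieAlgebra I G}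

/-- Conformality in terms of brackets: modulo the vertical plane, the symmetric part of `ad C` on
the horizontal plane is a multiple of the identity for each vertical `C`. -/
theorem exists_inner_bracket_of_isConformal (hmetric : IsLeftInvariantMetric I G)
    (hconformal : IsConformal 𝒱) :
    ∃ V : GroupLieAlgebra I G, ∀ A B C : GroupLieAlgebra I G,
      IsSectionNear (horizontal 𝒱) (mulInvariantVectorField A) 1 →
      IsSectionNear (horizontal 𝒱) (mulInvariantVectorField B) 1 → C ∈ 𝒱 1 →
      inner ℝ (E := TangentSpace I (1 : G)) ⁅C, A⁆ B +
        inner ℝ (E := TangentSpace I (1 : G)) ⁅C, B⁆ A =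
      2 * (inner ℝ (E := TangentSpace I (1 : G)) A B *
        inner ℝ (E := TangentSpace I (1 : G)) V C) := by
  obtain ⟨V, -, hV⟩ := hconformal
  refine ⟨V 1, fun A B C hA hB hC => ?_⟩
  have hC' : C ∈ horizontal (horizontal 𝒱) 1 :=
    Submodule.le_orthogonal_orthogonal (E := TangentSpace I (1 : G)) (𝒱 1) hC
  have h1 := inner_secondForm_mulInvariantVectorField hmetric A B hC'
  rw [hV 1 _ _ hA hB, real_inner_smul_left, inner_mulInvariantVectorField hmetric] at h1
  linarith

/-- Minimality in terms of brackets: for each horizontal `C`, the vertical part of `ad C` on the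
vertical plane has trace zero. -/
theorem inner_bracket_of_isMinimal (hmetric : IsLeftInvariantMetric I G)
    (h𝒱 : IsLeftInvariant 𝒱) (hrank : finrank ℝ (𝒱 1) = 2) (hminimal : IsMinimal 𝒱)
    (h : IsAdaptedFrame 𝒱 X Y Z W) (hZ : Z ∈ 𝒱 1) (hW : W ∈ 𝒱 1)
    {C : GroupLieAlgebra I G} (hC : C ∈ horizontal 𝒱 1) :
    inner ℝ (E := TangentSpace I (1 : G)) ⁅C, Z⁆ Z +
      inner ℝ (E := TangentSpace I (1 : G)) ⁅C, W⁆ W = 0 := by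
  let U : Fin 2 → GroupLieAlgebra I G := ![Z, W]
  have hU : ∀ i, U i ∈ 𝒱 1 := fun i => by fin_cases i <;> assumption
  have hon : Orthonormal ℝ (E := TangentSpace I (1 : G)) U := by
    have h' := h.1.comp (![2, 3] : Fin 2 → Fin 4) (by decide)
    rwa [show ![X, Y, Z, W] ∘ (![2, 3] : Fin 2 → Fin 4) = U by
      ext1 i; fin_cases i <;> rfl] at h'
  have h1 := hminimal 1 (fun i => mulInvariantVectorField (U (finCongr hrank i)))
    (fun i => isSectionNear_mulInvariantVectorField h𝒱 (hU _) 1) (by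
      simp only [mulInvariantVectorField_one]
      exact hon.comp _ (finCongr hrank).injective)
  rw [(finCongr hrank).sum_comp (fun i => secondForm 𝒱 (mulInvariantVectorField (U i))
    (mulInvariantVectorField (U i)) 1), Fin.sum_univ_two] at h1
  have h2 := congrArg (fun v => inner ℝ (E := TangentSpace I (1 : G)) v C) h1
  simp only [inner_add_left, inner_zero_left] at h2
  rw [inner_secondForm_mulInvariantVectorField hmetric _ _ hC,
    inner_secondForm_mulInvariantVectorField hmetric _ _ hC] at h2
  change 1 / 2 * (inner ℝ (E := TangentSpace I (1 : G)) ⁅C, Z⁆ Z +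
    inner ℝ (E := TangentSpace I (1 : G)) ⁅C, Z⁆ Z) +
    1 / 2 * (inner ℝ (E := TangentSpace I (1 : G)) ⁅C, W⁆ W +
    inner ℝ (E := TangentSpace I (1 : G)) ⁅C, W⁆ W) = 0 at h2
  linarith

theorem IsAdaptedFrame.exists_hasFrameBrackets (hmetric : IsLeftInvariantMetric I G)
    (hE : finrank ℝ E = 4) (hfoliation : IsFoliation 𝒱 2)
    (h𝒱 : IsLeftInvariant 𝒱) (hconformal : IsConformal 𝒱) (hminimal : IsMinimal 𝒱)
    (h : IsAdaptedFrame 𝒱 X Y Z W) :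
    ∃ μ lam α β z₁ w₁ z₂ w₂ a b z₃ z₄ r s θ₁ θ₂ : ℝ,
      HasFrameBrackets X Y Z W μ lam α β z₁ w₁ z₂ w₂ a b z₃ z₄ r s θ₁ θ₂ := by
  have hdim : finrank ℝ (TangentSpace I (1 : G)) = 4 := hE
  have hrank : finrank ℝ (𝒱 1) = 2 := by have := hfoliation.codim 1; omega
  have hspan := h.2 1
  rw [mulInvariantVectorField_one, mulInvariantVectorField_one] at hspan
  have hZ : Z ∈ 𝒱 1 := hspan ▸ Submodule.subset_span (by simp)
  have hW : W ∈ 𝒱 1 := hspan ▸ Submodule.subset_span (by simp)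
  obtain ⟨⟨hXX, hYY, hZZ, hWW⟩, hXY, hXZ, hXW, hYZ, hYW, hZW⟩ := orthonormal_four_iff.1 h.1
  have sX := isSectionNear_horizontal hmetric h (v := X) (by rwa [real_inner_comm])
    (by rwa [real_inner_comm]) 1
  have sY := isSectionNear_horizontal hmetric h (v := Y) (by rwa [real_inner_comm])
    (by rwa [real_inner_comm]) 1
  have hX : X ∈ horizontal 𝒱 1 := by
    simpa only [mulInvariantVectorField_one] using sX.self_of_nhds.2
  have hY : Y ∈ horizontal 𝒱 1 := by
    simpa only [mulInvariantVectorField_one] using sY.self_of_nhds.2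
  have hWZ : ⁅W, Z⁆ ∈ 𝒱 1 := hfoliation.involutive 1 _ _
    (isSectionNear_mulInvariantVectorField h𝒱 hW 1) (isSectionNear_mulInvariantVectorField h𝒱 hZ 1)
  obtain ⟨V, hV⟩ := exists_inner_bracket_of_isConformal hmetric hconformal
  have cZX := hV X X Z sX sX hZ
  have cZY := hV Y Y Z sY sY hZ
  have cZ := hV X Y Z sX sY hZ
  have cWX := hV X X W sX sX hW
  have cWY := hV Y Y W sY sY hW
  have cW := hV X Y W sX sY hW
  have mX := inner_bracket_of_isMinimal hmetric h𝒱 hrank hminimal h hZ hW hX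
  have mY := inner_bracket_of_isMinimal hmetric h𝒱 hrank hminimal h hZ hW hY
  rw [bracket_swap X Z, bracket_swap X W, inner_neg_left, inner_neg_left] at mX
  rw [bracket_swap Y Z, bracket_swap Y W, inner_neg_left, inner_neg_left] at mY
  rw [hXX] at cZX cWX
  rw [hYY] at cZY cWY
  rw [hXY] at cZ cW
  have exp := eq_sum_of_orthonormal hdim h.1
  let c (u v : GroupLieAlgebra I G) : ℝ := inner ℝ (E := TangentSpace I (1 : G)) u v
  refine ⟨c ⁅W, Z⁆ Z, c ⁅W, Z⁆ W, c ⁅Z, X⁆ X, c ⁅Z, X⁆ Y, c ⁅Z, X⁆ Z, c ⁅Z, X⁆ W, c ⁅Z, Y⁆ Z,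
    c ⁅Z, Y⁆ W, c ⁅W, X⁆ X, c ⁅W, X⁆ Y, c ⁅W, X⁆ Z, c ⁅W, Y⁆ Z, c ⁅Y, X⁆ X, c ⁅Y, X⁆ Y, c ⁅Y, X⁆ Z,
    c ⁅Y, X⁆ W, ?_, exp _, ?_, ?_, ?_, exp _⟩
  · have e1 : c ⁅W, Z⁆ X = 0 := hX _ hWZ
    have e2 : c ⁅W, Z⁆ Y = 0 := hY _ hWZ
    have := exp ⁅W, Z⁆
    change ⁅W, Z⁆ = c ⁅W, Z⁆ X • X + c ⁅W, Z⁆ Y • Y + c ⁅W, Z⁆ Z • Z + c ⁅W, Z⁆ W • W at this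
    rwa [e1, e2, zero_smul, zero_smul, add_zero, zero_add] at this
  · have e1 : c ⁅Z, Y⁆ X = -c ⁅Z, X⁆ Y := by simp only [c]; linarith
    have e2 : c ⁅Z, Y⁆ Y = c ⁅Z, X⁆ X := by simp only [c]; linarith
    rw [← e1, ← e2]
    exact exp _
  · have e1 : c ⁅W, X⁆ W = -c ⁅Z, X⁆ Z := by simp only [c]; linarith
    rw [← e1]
    exact exp _
  · have e1 : c ⁅W, Y⁆ X = -c ⁅W, X⁆ Y := by simp only [c]; linarith
    have e2 : c ⁅W, Y⁆ Y = c ⁅W, X⁆ X := by simp only [c]; linarith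
    have e3 : c ⁅W, Y⁆ W = -c ⁅Z, Y⁆ Z := by simp only [c]; linarith
    rw [← e1, ← e2, ← e3]
    exact exp _

end FrameBrackets

end LieGroupGeometry

open Bundle in
theorem mainTheorem1
    (G : Type*) [TopologicalSpace G] [ChartedSpace (EuclideanSpace ℝ (Fin 4)) G] [Group G]
    [LieGroup (𝓡 4) ∞ G]
    [RiemannianBundle (fun x : G => TangentSpace (𝓡 4) x)]
    [IsContMDiffRiemannianBundle (𝓡 4) ∞ (EuclideanSpace ℝ (Fin 4))
      (fun x : G => TangentSpace (𝓡 4) x)]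
    (hmetric : LieGroupGeometry.IsLeftInvariantMetric (𝓡 4) G)
    (𝒱 : Π x : G, Submodule ℝ (TangentSpace (𝓡 4) x))
    (hfoliation : Foliation.IsFoliation 𝒱 2)
    (hinvariant : LieGroupGeometry.IsLeftInvariant 𝒱)
    (hconformal : Foliation.IsConformal 𝒱)
    (hminimal : Foliation.IsMinimal 𝒱) :
    ∃ X Y Z W : GroupLieAlgebra (𝓡 4) G,
      LieGroupGeometry.IsAdaptedFrame 𝒱 X Y Z W ∧
        LieGroupGeometry.InFamilies X Y Z W := by
  have hE : Module.finrank ℝ (EuclideanSpace ℝ (Fin 4)) = 4 := finrank_euclideanSpace_fin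
  have hrank : ∀ g, Module.finrank ℝ (𝒱 g) = 2 := fun g => by
    have h1 := hfoliation.codim g
    have h2 : Module.finrank ℝ (TangentSpace (𝓡 4) g) = 4 := hE
    omega
  let P (X Y Z W : GroupLieAlgebra (𝓡 4) G) : Prop :=
    Orthonormal ℝ (E := TangentSpace (𝓡 4) (1 : G)) ![X, Y, Z, W] ∧ Z ∈ 𝒱 1 ∧ W ∈ 𝒱 1
  have hP : ∀ {X Y Z W}, P X Y Z W → LieGroupGeometry.IsAdaptedFrame 𝒱 X Y Z W := fun h =>
    LieGroupGeometry.isAdaptedFrame_of_mem hmetric hinvariant hrank h.1 h.2.1 h.2.2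
  obtain ⟨X, Y, Z, W, h0⟩ := LieGroupGeometry.exists_orthonormal_of_finrank
    (F := TangentSpace (𝓡 4) (1 : G)) hE (hrank 1)
  obtain ⟨_, _, _, _, _, _, _, _, _, _, _, _, _, _, _, _, h1⟩ := (hP h0).exists_hasFrameBrackets
    hmetric hE hfoliation hinvariant hconformal hminimal
  have := LieGroupGeometry.lieGroup_minSmoothness (I := 𝓡 4) (G := G)
  obtain ⟨X', Y', Z', W', h2, h3⟩ := LieGroupGeometry.exists_frame_inFamilies (P := P)
    (fun h => h.1.linearIndependent)
    (fun hpq h => ⟨LieGroupGeometry.orthonormal_rotate_horizontal h.1 hpq, h.2⟩)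
    (fun hpq h => ⟨LieGroupGeometry.orthonormal_rotate_vertical h.1 hpq,
      add_mem (Submodule.smul_mem _ _ h.2.1) (Submodule.smul_mem _ _ h.2.2),
      add_mem (Submodule.smul_mem _ _ h.2.1) (Submodule.smul_mem _ _ h.2.2)⟩) h0 h1
  exact ⟨X', Y', Z', W', hP h2, h3⟩
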